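/- **Model.** For integers $1\le n_L<n$ and $T\ge 1$, the hub model with the null component has parameters $\rho=(\rho_0,\dots,\rho_{n_L})$, a probability vector, and $A=[A_{ij}]_{0\le i\le n_L,\,1\le j\le n}$ with $A_{ij}\in[0,1]$ and $A_{ii}=1$ for $1\le i\le n_L$; the row $A_{0\cdot}=\pi$ is the null row. One observes $G=(G_j^{(t)})_{t\le T,\,j\le n}\in\{0,1\}^{T\times n}$, generated independently over $t$: a latent label $z_*^{(t)}\in\{0,\dots,n_L\}$ is drawn with $\mathbb P(z_*^{(t)}=i)=\rho_i$, and given $z_*^{(t)}=i$ the $G_j^{(t)}$, $j=1,\dots,n$, are independent with $\mathbb P(G_j^{(t)}=1\mid z_*^{(t)}=i)=A_{ij}$. (Label $0$ means a hubless group; the hub set is $\{1,\dots,n_L\}$.) **Estimator.** For $z\in\{0,\dots,n_L\}^T$ put $t_i=\#\{t:z^{(t)}=i\}$, $\hat A_{ij}^z=t_i^{-1}\sum_t G_j^{(t)}1(z^{(t)}=i)$ if $t_i>0$ and $\hat A_{ij}^z=0$ otherwise, and $$L_G(z)=\sum_{t}\sum_{j} \Big[G_j^{(t)}\log \hat A^z_{z^{(t)},j}+(1-G_j^{(t)})\log\big(1-\hat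 A^z_{z^{(t)},j}\big)\Big],\qquad 0\log 0=0.$$ Let $\hat z$ be any maximizer of $L_G$ over the feasible $z$, i.e. those such that $z^{(t)}=i\ge1$ implies $G_i^{(t)}=1$ (all others have likelihood $0$ because $A_{ii}=1$). **Theorem.** Consider a sequence of such models along which $n_L\to\infty$, $n\to\infty$, $T\to\infty$, where $\rho$, $A$, $d>0$ and $v>0$ may vary along the sequence, and suppose that there are constants $c_{\min},s_{\min},\tau_0,c_0>0$ and $c_{\max},s_{\max}<\infty$ such that * $H_1^*$: with probability tending to $1$, $Tc_{\min}/n_L\le t_{i*}\le Tc_{\max}/n_L$ for all $i=0,\dots,n_L$, where $t_{i*}=\#\{t:z_*^{(t)}=i\}$; * $H_2^*$: $A_{ij}=s_{ij}d$ for $i=0,\dots,n_L$, $j=1,\dots,n$, $i\ne j$, with $s_{\min}\le s_{ij}\le s_{\max}$, and $d\to0$; * $H_3^*$: for every $i=1,\dots,n_L$ there is a set $V_i\subset\{n_L+1,\dots,n\}$ with $|V_i|\ge vn/n_L$ and $s_{ij}-s_{i'j}\ge\tau_0$ for all $j\in V_i$ and all $i'\in\{0,\dots,n_L\}$, $i'\neq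 i$; * $H_4^*$: $A_{ii'}\le c_0/n_L$ for $i=0,\dots,n_L$, $i'=1,\dots,n_L$, $i\ne i'$. If $$\frac{n_L\log n}{T}\to0,\qquad \frac{n_L^5\log T}{dTv}\to0,\qquad \frac{(\log d)^2n_L^8\log n_L}{dnv^2}\to0,\qquad \frac{(\log T)^2n_L^8\log n_L}{dnv^2}\to0,$$ then $$\max_{0\le i\le n_L,\;1\le j\le n}\big|\hat A_{ij}^{\hat z}-A_{ij}\big|=o_p(1),$$ that is, for every $\varepsilon>0$, the probability that the maximum is at least $\varepsilon$ tends to $0$. -/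

import Mathlib

open MeasureTheory Filter Topology

namespace HubNull

/-! Hub model with the null component. Nodes are the elements of `Fin n` (node `j` of the usual
one-based numbering is the element with value `j - 1`), labels are the elements of `Fin (L + 1)`,
label `0` being the null component; the hub set consists of the first `L` nodes. -/

/-- Label `i` is the hub label of node `j`. It never holds for the null label `i = 0`. -/
def IsHubOf {L n : ℕ} (i : Fin (L + 1)) (j : Fin n) : Prop := (i : ℕ) = (j : ℕ) + 1

/-- Node `j` is a follower: it is not in the hub set. -/
def IsFollower (L : ℕ) {n : ℕ} (j : Fin n) : Prop := L ≤ (j : ℕ)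

/-- The numerical value `0` or `1` of a membership indicator. -/
def ind (b : Bool) : ℝ := if b then 1 else 0

/-- Admissible parameters: `ρ` is a probability vector on the labels, `A` has entries in `[0, 1]`,
and a hub surely appears in the groups that it forms. Row `0` of `A` is the null row `π`. -/
structure IsParam {L n : ℕ} (ρ : Fin (L + 1) → ℝ) (A : Fin (L + 1) → Fin n → ℝ) : Prop where
  rho_nonneg : ∀ i, 0 ≤ ρ i
  rho_sum : ∑ i, ρ i = 1
  nonneg : ∀ i j, 0 ≤ A i j
  le_one : ∀ i j, A i j ≤ 1
  hub : ∀ i j, IsHubOf i j → A i j = 1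

/-- Probability that one observation has label `i` and is the group `g`. -/
def weight {L n : ℕ} (ρ : Fin (L + 1) → ℝ) (A : Fin (L + 1) → Fin n → ℝ)
    (i : Fin (L + 1)) (g : Fin n → Bool) : ℝ :=
  ρ i * ∏ j, (if g j then A i j else 1 - A i j)

/-- `(z, G)` is a sample of size `T` from the hub model with the null component: the pairs
`(z t, G t)` are independent, `z t` has law `ρ`, and given `z t = i` node `j` appears in group `t`
with probability `A i j`, independently over `j`. -/
structure IsHubSample {Ω : Type*} [MeasurableSpace Ω] (P : Measure Ω) {L n T : ℕ}
    (ρ : Fin (L + 1) → ℝ) (A : Fin (L + 1) → Fin n → ℝ)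
    (z : Ω → Fin T → Fin (L + 1)) (G : Ω → Fin T → Fin n → Bool) : Prop where
  measurable_label : Measurable z
  measurable_group : Measurable G
  law : ∀ (ζ : Fin T → Fin (L + 1)) (g : Fin T → Fin n → Bool),
    P.real {ω | z ω = ζ ∧ G ω = g} = ∏ t, weight ρ A (ζ t) (g t)

/-- The number of groups with label `i`. -/
def labelCount {L T : ℕ} (z : Fin T → Fin (L + 1)) (i : Fin (L + 1)) : ℕ :=
  (Finset.univ.filter fun t => z t = i).card

/-- The estimator of `A` given the labels `z`; it is `0` in a row whose label is not used. -/
noncomputable def Ahat {L n T : ℕ} (G : Fin T → Fin n → Bool) (z : Fin T → Fin (L + 1))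
    (i : Fin (L + 1)) (j : Fin n) : ℝ :=
  (∑ t, if z t = i then ind (G t j) else 0) / (labelCount z i : ℝ)

/-- The profile log-likelihood of a label assignment (`0 * Real.log 0 = 0`). -/
noncomputable def profileLogLik {L n T : ℕ} (G : Fin T → Fin n → Bool)
    (z : Fin T → Fin (L + 1)) : ℝ :=
  ∑ t, ∑ j, (ind (G t j) * Real.log (Ahat G z (z t) j)
    + (1 - ind (G t j)) * Real.log (1 - Ahat G z (z t) j))

/-- A label assignment is feasible when every assigned hub appears in its group; under the
constraint that a hub surely appears, every other assignment has likelihood zero. -/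
def Feasible {L n T : ℕ} (G : Fin T → Fin n → Bool) (z : Fin T → Fin (L + 1)) : Prop :=
  ∀ t j, IsHubOf (z t) j → G t j = true

/-- `z` is a maximum profile likelihood estimate of the labels. -/
def IsMPLE {L n T : ℕ} (G : Fin T → Fin n → Bool) (z : Fin T → Fin (L + 1)) : Prop :=
  Feasible G z ∧ ∀ z' : Fin T → Fin (L + 1), Feasible G z' → profileLogLik G z' ≤ profileLogLik G z

/-- The maximal entrywise error of the estimator of `A` (null row included). -/
noncomputable def maxError {L n T : ℕ} (A : Fin (L + 1) → Fin n → ℝ) (G : Fin T → Fin n → Bool)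
    (z : Fin T → Fin (L + 1)) : ℝ :=
  ⨆ p : Fin (L + 1) × Fin n, |Ahat G z p.1 p.2 - A p.1 p.2|

/-- All label frequencies, that of the null label included, are of order `T / L`. -/
def BalancedLabels {L T : ℕ} (cmin cmax : ℝ) (z : Fin T → Fin (L + 1)) : Prop :=
  ∀ i, (T : ℝ) * cmin / L ≤ labelCount z i ∧ (labelCount z i : ℝ) ≤ (T : ℝ) * cmax / L

/-- Off the entries `A i i`, `A = d • s` with `smin ≤ s ≤ smax`. -/
def ScaledEntries {L n : ℕ} (smin smax d : ℝ) (s A : Fin (L + 1) → Fin n → ℝ) : Prop :=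
  ∀ i j, ¬ IsHubOf i j → A i j = s i j * d ∧ smin ≤ s i j ∧ s i j ≤ smax

/-- Every hub has at least `v n / L` followers that prefer it, by a margin of at least `τ`, to all
other hubs and to the null component. -/
def SeparatedHubs {L n : ℕ} (v τ : ℝ) (s : Fin (L + 1) → Fin n → ℝ) : Prop :=
  ∀ i, i ≠ 0 → ∃ V : Finset (Fin n), (∀ j ∈ V, IsFollower L j) ∧ v * n / L ≤ (V.card : ℝ) ∧
    ∀ j ∈ V, ∀ i', i' ≠ i → τ ≤ s i j - s i' j

/-- Hub set members join groups of other hubs and hubless groups with probability `≤ c₀ / L`. -/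
def RareHubs {L n : ℕ} (c₀ : ℝ) (A : Fin (L + 1) → Fin n → ℝ) : Prop :=
  ∀ i j, ¬ IsFollower L j → ¬ IsHubOf i j → A i j ≤ c₀ / L

end HubNull

/-! Write `R = T / L`. Since `d → 0`, the entries of `A` off the hub positions tend to `0`
uniformly, and feasibility makes the hub entries of the estimator equal to `1` on every nonempty
class. Hence it suffices that each estimated class has order `R` members and that a node other than
its hub occurs in fewer than a small multiple `η R` of them. The labels need not be recovered
exactly.

Sizes: by `RareHubs`, a fixed proportion of the groups with true label `i` contain no foreign hub,
and feasibility leaves them only the labels `0` and `i`. Occurrences: a group wrongly given the hub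
label `i` contains that hub as a foreign node, and few groups contain both a foreign hub and another
prescribed node. These are Chernoff bounds (`condProb_card_foreignHubs_le`,
`condProb_le_card_class`, `condProb_le_card_foreign`).

The null label imposes no constraint, and only there is the likelihood needed: fewer than `η R` hub
groups may be labelled `0`. Otherwise one row of estimates serves many null groups and many hub
groups at once, and on the followers preferring those hubs no row fits both. This forces a squared
Hellinger distance of order `v n d T / L²` (`le_sum_sq_sqrt_sub_sqrt`). A fixed assignment with a
fixed estimate beats the truth with probability exponentially small in that distance, up to the cost
`T L log 2` of ignoring the hub columns. The rates pay for this cost and for a union over `(L +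
1)^T` assignments and `(T + 1)^(2n(L + 1))` estimates (`condProb_exists_profileLogLik_le`,
`log_complexity_le`).

`maxError_lt` is the deterministic deduction, and `condProb_le_maxError_le` assembles the
probabilities. -/

namespace HubNull

/-! ### Conditional laws given the labels, and Chernoff's bound -/

/-- The mass function of a Bernoulli variable with success probability `p`. -/
def bern (p : ℝ) (b : Bool) : ℝ := if b then p else 1 - p

lemma bern_nonneg {p : ℝ} (h0 : 0 ≤ p) (h1 : p ≤ 1) (b : Bool) : 0 ≤ bern p b := by
  cases b <;> simp [bern, h0, h1]

lemma sum_bern (p : ℝ) : ∑ b, bern p b = 1 := by simp [bern]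

/-- The conditional probability of the groups `g` given the labels `ζ`. -/
def condWeight {L n T : ℕ} (A : Fin (L + 1) → Fin n → ℝ) (ζ : Fin T → Fin (L + 1))
    (g : Fin T → Fin n → Bool) : ℝ :=
  ∏ t, ∏ j, bern (A (ζ t) j) (g t j)

open Classical in
/-- The conditional probability of a set of samples of groups given the labels `ζ`. -/
noncomputable def condProb {L n T : ℕ} (A : Fin (L + 1) → Fin n → ℝ) (ζ : Fin T → Fin (L + 1))
    (S : Set (Fin T → Fin n → Bool)) : ℝ :=
  ∑ g, if g ∈ S then condWeight A ζ g else 0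

section condProb

variable {L n T : ℕ} {A : Fin (L + 1) → Fin n → ℝ} {ζ : Fin T → Fin (L + 1)}

lemma condWeight_nonneg (h0 : ∀ i j, 0 ≤ A i j) (h1 : ∀ i j, A i j ≤ 1)
    (g : Fin T → Fin n → Bool) : 0 ≤ condWeight A ζ g :=
  Finset.prod_nonneg fun _ _ => Finset.prod_nonneg fun _ _ => bern_nonneg (h0 _ _) (h1 _ _) _

/-- Samples of weight zero are exempt from the inclusion, so that feasibility of the true labels may
be used in proving it. -/
lemma condProb_mono (h0 : ∀ i j, 0 ≤ A i j) (h1 : ∀ i j, A i j ≤ 1)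
    {S S' : Set (Fin T → Fin n → Bool)}
    (h : ∀ g ∈ S, condWeight A ζ g ≠ 0 → g ∈ S') : condProb A ζ S ≤ condProb A ζ S' := by
  classical
  refine Finset.sum_le_sum fun g _ => ?_
  have := condWeight_nonneg (ζ := ζ) h0 h1 g
  by_cases hg : g ∈ S
  · by_cases hw : condWeight A ζ g = 0
    · simp [hw]
    · simp [hg, h g hg hw]
  · rw [if_neg hg]; split_ifs <;> simp [this]

lemma condProb_union_le (h0 : ∀ i j, 0 ≤ A i j) (h1 : ∀ i j, A i j ≤ 1)
    (S S' : Set (Fin T → Fin n → Bool)) :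
    condProb A ζ (S ∪ S') ≤ condProb A ζ S + condProb A ζ S' := by
  classical
  unfold condProb
  rw [← Finset.sum_add_distrib]
  refine Finset.sum_le_sum fun g _ => ?_
  have := condWeight_nonneg (ζ := ζ) h0 h1 g
  by_cases hg : g ∈ S <;> by_cases hg' : g ∈ S' <;> simp [hg, hg', this]

lemma condProb_iUnion_le (h0 : ∀ i j, 0 ≤ A i j) (h1 : ∀ i j, A i j ≤ 1) {ι : Type*} [Fintype ι]
    (S : ι → Set (Fin T → Fin n → Bool)) {b : ℝ} (hb : ∀ i, condProb A ζ (S i) ≤ b) :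
    condProb A ζ (⋃ i, S i) ≤ Fintype.card ι * b := by
  classical
  have h : condProb A ζ (⋃ i, S i) ≤ ∑ i, condProb A ζ (S i) := by
    unfold condProb
    rw [Finset.sum_comm]
    refine Finset.sum_le_sum fun g _ => ?_
    have := condWeight_nonneg (ζ := ζ) h0 h1 g
    by_cases hg : g ∈ ⋃ i, S i
    · obtain ⟨i, hi⟩ := Set.mem_iUnion.1 hg
      rw [if_pos hg]
      calc condWeight A ζ g = if g ∈ S i then condWeight A ζ g else 0 := by simp [hi]
        _ ≤ _ := Finset.single_le_sum (f := fun i => if g ∈ S i then condWeight A ζ g else 0)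
          (fun i _ => by split_ifs <;> simp [this]) (Finset.mem_univ i)
    · rw [if_neg hg]
      exact Finset.sum_nonneg fun i _ => by split_ifs <;> simp [this]
  refine h.trans ((Finset.sum_le_sum fun i _ => hb i).trans ?_)
  simp

end condProb

lemma sum_prod_apply {ι κ : Type*} [Fintype ι] [DecidableEq ι] [Fintype κ] (f : ι → κ → ℝ) :
    ∑ x : ι → κ, ∏ i, f i (x i) = ∏ i, ∑ b, f i b := by
  rw [Finset.prod_univ_sum, Fintype.piFinset_univ]

lemma sum_prod_prod_apply {n T : ℕ} (f : Fin T → Fin n → Bool → ℝ) :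
    ∑ g : Fin T → Fin n → Bool, ∏ t, ∏ j, f t j (g t j) = ∏ t, ∏ j, ∑ b, f t j b := by
  rw [sum_prod_apply (fun t (x : Fin n → Bool) => ∏ j, f t j (x j))]
  exact Finset.prod_congr rfl fun t _ => sum_prod_apply (f t)

/-- The probability that all coordinates in `S` of a vector of independent Bernoulli variables take
the value `b`. -/
lemma sum_prod_bern_of_forall {n : ℕ} (a : Fin n → ℝ) (S : Finset (Fin n)) (b : Bool) :
    (∑ x : Fin n → Bool, if ∀ j ∈ S, x j = b then ∏ j, bern (a j) (x j) else 0) =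
      ∏ j ∈ S, bern (a j) b := by
  classical
  have h : ∀ x : Fin n → Bool, (if ∀ j ∈ S, x j = b then ∏ j, bern (a j) (x j) else 0) =
      ∏ j, (if j ∈ S ∧ x j ≠ b then 0 else bern (a j) (x j)) := by
    intro x
    split_ifs with hx
    · refine Finset.prod_congr rfl fun j _ => ?_
      rw [if_neg]; rintro ⟨h1, h2⟩; exact h2 (hx j h1)
    · push Not at hx
      obtain ⟨j, hj, hjb⟩ := hx
      refine (Finset.prod_eq_zero (Finset.mem_univ j) ?_).symm
      rw [if_pos ⟨hj, hjb⟩]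
  simp_rw [h]
  rw [sum_prod_apply (fun j c => if j ∈ S ∧ c ≠ b then 0 else bern (a j) c),
    ← Finset.prod_subset (Finset.subset_univ S)]
  · refine Finset.prod_congr rfl fun j hj => ?_
    cases b <;> simp [hj]
  · intro j _ hj
    simpa [hj] using sum_bern (a j)

open Classical in
/-- Chernoff's bound for the number of groups that belong to prescribed sets. -/
lemma condProb_count_le {L n T : ℕ} {A : Fin (L + 1) → Fin n → ℝ} {ζ : Fin T → Fin (L + 1)}
    (h0 : ∀ i j, 0 ≤ A i j) (h1 : ∀ i j, A i j ≤ 1) (E : Fin T → Set (Fin n → Bool)) (l a : ℝ)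
    (S : Set (Fin T → Fin n → Bool))
    (hS : ∀ g ∈ S, 0 ≤ l * (((Finset.univ.filter fun t => g t ∈ E t).card : ℝ) - a)) :
    condProb A ζ S ≤ Real.exp (-(l * a) + (Real.exp l - 1) *
      ∑ t, ∑ x, if x ∈ E t then ∏ j, bern (A (ζ t) j) (x j) else 0) := by
  have hw : ∀ t (x : Fin n → Bool), 0 ≤ ∏ j, bern (A (ζ t) j) (x j) := fun t x =>
    Finset.prod_nonneg fun _ _ => bern_nonneg (h0 _ _) (h1 _ _) _
  have hsum : ∀ t, ∑ x : Fin n → Bool, ∏ j, bern (A (ζ t) j) (x j) = 1 := fun t => by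
    rw [sum_prod_apply (fun j => bern (A (ζ t) j))]
    exact Finset.prod_eq_one fun j _ => sum_bern _
  -- Exponential Markov inequality: on `S` the factor `exp (l * (count - a))` is at least `1`. The
  -- sign of `l` is free, which covers both tails.
  calc condProb A ζ S ≤ ∑ g : Fin T → Fin n → Bool, Real.exp (-(l * a)) *
        ∏ t, ((∏ j, bern (A (ζ t) j) (g t j)) * Real.exp (if g t ∈ E t then l else 0)) := by
        refine Finset.sum_le_sum fun g _ => ?_
        rw [Finset.prod_mul_distrib, ← Real.exp_sum, mul_left_comm, ← Real.exp_add]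
        have hc : ∑ t, (if g t ∈ E t then l else 0) =
            l * ((Finset.univ.filter fun t => g t ∈ E t).card : ℝ) := by
          rw [← Finset.sum_filter, Finset.sum_const, nsmul_eq_mul, mul_comm]
        rw [hc]
        have hp := condWeight_nonneg (ζ := ζ) h0 h1 g
        split_ifs with hg
        · have := hS g hg
          refine le_mul_of_one_le_right hp (Real.one_le_exp ?_)
          linarith
        · exact mul_nonneg hp (Real.exp_pos _).le
    _ = Real.exp (-(l * a)) * ∏ t, (1 + (Real.exp l - 1) *
          ∑ x, if x ∈ E t then ∏ j, bern (A (ζ t) j) (x j) else 0) := by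
        rw [← Finset.mul_sum]
        congr 1
        rw [sum_prod_apply (fun t (x : Fin n → Bool) =>
          (∏ j, bern (A (ζ t) j) (x j)) * Real.exp (if x ∈ E t then l else 0))]
        refine Finset.prod_congr rfl fun t _ => ?_
        calc _ = ∑ x : Fin n → Bool, (∏ j, bern (A (ζ t) j) (x j) + (Real.exp l - 1) *
              if x ∈ E t then ∏ j, bern (A (ζ t) j) (x j) else 0) := by
              refine Finset.sum_congr rfl fun x _ => ?_
              split_ifs
              · ring
              · simp
          _ = _ := by rw [Finset.sum_add_distrib, hsum, ← Finset.mul_sum]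
    _ ≤ Real.exp (-(l * a)) * ∏ t, Real.exp ((Real.exp l - 1) *
          ∑ x, if x ∈ E t then ∏ j, bern (A (ζ t) j) (x j) else 0) := by
        refine mul_le_mul_of_nonneg_left (Finset.prod_le_prod ?_ ?_) (Real.exp_pos _).le
        · intro t _
          have hq0 : 0 ≤ ∑ x, if x ∈ E t then ∏ j, bern (A (ζ t) j) (x j) else 0 :=
            Finset.sum_nonneg fun x _ => by split_ifs <;> simp [hw t x]
          have hq1 : (∑ x, if x ∈ E t then ∏ j, bern (A (ζ t) j) (x j) else 0) ≤ 1 := by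
            rw [← hsum t]
            exact Finset.sum_le_sum fun x _ => by split_ifs <;> simp [hw t x]
          nlinarith [Real.exp_pos l, mul_nonneg (Real.exp_pos l).le hq0]
        · intro t _
          rw [add_comm]
          exact Real.add_one_le_exp _
    _ = _ := by rw [← Real.exp_sum, ← Real.exp_add, Finset.mul_sum]

lemma prod_weight_eq {L n T : ℕ} (ρ : Fin (L + 1) → ℝ) (A : Fin (L + 1) → Fin n → ℝ)
    (ζ : Fin T → Fin (L + 1)) (g : Fin T → Fin n → Bool) :
    ∏ t, weight ρ A (ζ t) (g t) = (∏ t, ρ (ζ t)) * condWeight A ζ g := by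
  simp only [weight, condWeight, bern, Finset.prod_mul_distrib]

/-- A bound on conditional probabilities given the labels is a bound on probabilities. -/
lemma IsHubSample.real_le_of_condProb_le {Ω : Type*} [MeasurableSpace Ω] {P : Measure Ω}
    [IsProbabilityMeasure P] {L n T : ℕ}
    {ρ : Fin (L + 1) → ℝ} {A : Fin (L + 1) → Fin n → ℝ} {z : Ω → Fin T → Fin (L + 1)}
    {G : Ω → Fin T → Fin n → Bool} (hρA : IsParam ρ A) (h : IsHubSample P ρ A z G)
    (Z : Set (Fin T → Fin (L + 1))) (S : Set (Fin T → Fin n → Bool)) {b : ℝ} (hb : 0 ≤ b)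
    (hS : ∀ ζ ∈ Z, condProb A ζ S ≤ b) :
    P.real {ω | z ω ∈ Z ∧ G ω ∈ S} ≤ b := by
  classical
  -- A finite cover by atoms of known probability; only subadditivity is used.
  have hcover : {ω | z ω ∈ Z ∧ G ω ∈ S} ⊆
      ⋃ p ∈ (Finset.univ.filter fun p : (Fin T → Fin (L + 1)) × (Fin T → Fin n → Bool) =>
        p.1 ∈ Z ∧ p.2 ∈ S), {ω | z ω = p.1 ∧ G ω = p.2} := by
    intro ω hω
    simp only [Set.mem_iUnion]
    exact ⟨(z ω, G ω), by simpa using hω, rfl, rfl⟩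
  calc P.real {ω | z ω ∈ Z ∧ G ω ∈ S}
      ≤ ∑ p ∈ (Finset.univ.filter fun p : (Fin T → Fin (L + 1)) × (Fin T → Fin n → Bool) =>
        p.1 ∈ Z ∧ p.2 ∈ S), P.real {ω | z ω = p.1 ∧ G ω = p.2} :=
        (measureReal_mono hcover (measure_ne_top _ _)).trans (measureReal_biUnion_finset_le _ _)
    _ = ∑ ζ, if ζ ∈ Z then (∏ t, ρ (ζ t)) * condProb A ζ S else 0 := by
        rw [Finset.sum_filter, Fintype.sum_prod_type]
        refine Finset.sum_congr rfl fun ζ _ => ?_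
        by_cases hζ : ζ ∈ Z
        · simp only [hζ, true_and, if_true, condProb, Finset.mul_sum]
          refine Finset.sum_congr rfl fun g _ => ?_
          split_ifs
          · rw [h.law, prod_weight_eq]
          · simp
        · simp [hζ]
    _ ≤ ∑ ζ : Fin T → Fin (L + 1), (∏ t, ρ (ζ t)) * b := by
        refine Finset.sum_le_sum fun ζ _ => ?_
        have hp : 0 ≤ ∏ t, ρ (ζ t) := Finset.prod_nonneg fun _ _ => hρA.rho_nonneg _
        split_ifs with hζ
        · exact mul_le_mul_of_nonneg_left (hS ζ hζ) hp
        · exact mul_nonneg hp hb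
    _ = b := by
        rw [← Finset.sum_mul, sum_prod_apply (fun _ => ρ)]
        simp [hρA.rho_sum]

/-! ### The profile log-likelihood -/

lemma log_bern (p : ℝ) (b : Bool) :
    ind b * Real.log p + (1 - ind b) * Real.log (1 - p) = Real.log (bern p b) := by
  cases b <;> simp [ind, bern]

lemma profileLogLik_eq {L n T : ℕ} (g : Fin T → Fin n → Bool) (z : Fin T → Fin (L + 1)) :
    profileLogLik g z = ∑ t, ∑ j, Real.log (bern (Ahat g z (z t) j) (g t j)) := by
  simp only [profileLogLik, log_bern]

/-- Gibbs' inequality for Bernoulli laws. -/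
lemma mul_log_add_mul_log_le {a b : ℝ} (ha0 : 0 ≤ a) (ha1 : a ≤ 1) (hb0 : 0 < b) (hb1 : b < 1) :
    a * Real.log b + (1 - a) * Real.log (1 - b) ≤
      a * Real.log a + (1 - a) * Real.log (1 - a) := by
  -- This is `log u ≤ u - 1` at `u = y / x`; the remainders `y - x` of the two outcomes cancel.
  have key : ∀ {x y : ℝ}, 0 ≤ x → 0 < y → x * Real.log y ≤ x * Real.log x + (y - x) := by
    intro x y hx hy
    rcases hx.eq_or_lt with rfl | hx
    · simp [hy.le]
    · have h := Real.log_le_sub_one_of_pos (div_pos hy hx)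
      rw [Real.log_div hy.ne' hx.ne'] at h
      have h2 := mul_le_mul_of_nonneg_left h hx.le
      have h3 : x * (y / x - 1) = y - x := by field_simp
      linarith
  have h1 := key ha0 hb0
  have h2 := key (sub_nonneg.2 ha1) (sub_pos.2 hb1)
  linarith

section Ahat

variable {L n T : ℕ} (g : Fin T → Fin n → Bool) (z : Fin T → Fin (L + 1))

lemma Ahat_eq_card_div (i : Fin (L + 1)) (j : Fin n) :
    Ahat g z i j = ((Finset.univ.filter fun t => z t = i ∧ g t j = true).card : ℝ) /
      labelCount z i := by
  unfold Ahat
  congr 1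
  rw [Finset.card_filter]
  push_cast
  refine Finset.sum_congr rfl fun t _ => ?_
  by_cases h : z t = i <;> by_cases h' : g t j = true <;> simp [h, h', ind]

lemma card_filter_le_labelCount (i : Fin (L + 1)) (j : Fin n) :
    (Finset.univ.filter fun t => z t = i ∧ g t j = true).card ≤ labelCount z i :=
  Finset.card_le_card (Finset.monotone_filter_right _ fun _ _ h => h.1)

lemma Ahat_nonneg (i : Fin (L + 1)) (j : Fin n) : 0 ≤ Ahat g z i j := by
  rw [Ahat_eq_card_div]; positivity

lemma Ahat_le_one (i : Fin (L + 1)) (j : Fin n) : Ahat g z i j ≤ 1 := by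
  rw [Ahat_eq_card_div]
  exact div_le_one_of_le₀ (by exact_mod_cast card_filter_le_labelCount g z i j) (by positivity)

lemma bern_Ahat_pos (t : Fin T) (j : Fin n) : 0 < bern (Ahat g z (z t) j) (g t j) := by
  have hm : 0 < labelCount z (z t) :=
    Finset.card_pos.2 ⟨t, by simp⟩
  have hm' : (0 : ℝ) < labelCount z (z t) := by exact_mod_cast hm
  rw [Ahat_eq_card_div]
  by_cases h : g t j = true
  · have : 0 < (Finset.univ.filter fun t' => z t' = z t ∧ g t' j = true).card :=
      Finset.card_pos.2 ⟨t, by simp [h]⟩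
    simp only [bern, h, if_true]
    positivity
  · have : (Finset.univ.filter fun t' => z t' = z t ∧ g t' j = true).card <
        labelCount z (z t) := by
      refine Finset.card_lt_card ⟨Finset.monotone_filter_right _ fun _ _ h => h.1, fun hs => ?_⟩
      have := hs (show t ∈ Finset.univ.filter fun t' => z t' = z t by simp)
      simp [h] at this
    simp only [bern, h, Bool.false_eq_true, if_false, sub_pos]
    rw [div_lt_one hm']
    exact_mod_cast this

/-- The profile log-likelihood is the maximum of the log-likelihood over the parameters. -/
lemma le_profileLogLik {B : Fin (L + 1) → Fin n → ℝ} (h0 : ∀ i j, 0 < B i j)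
    (h1 : ∀ i j, B i j < 1) :
    ∑ t, ∑ j, Real.log (bern (B (z t) j) (g t j)) ≤ profileLogLik g z := by
  have key : ∀ C : Fin (L + 1) → Fin n → ℝ, ∑ t, ∑ j, Real.log (bern (C (z t) j) (g t j)) =
      ∑ j, ∑ i, (labelCount z i : ℝ) *
        (Ahat g z i j * Real.log (C i j) + (1 - Ahat g z i j) * Real.log (1 - C i j)) := by
    intro C
    rw [Finset.sum_comm]
    refine Finset.sum_congr rfl fun j _ => ?_
    rw [← Finset.sum_fiberwise Finset.univ z]
    refine Finset.sum_congr rfl fun i _ => ?_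
    have h : ∀ t ∈ Finset.univ.filter (fun t => z t = i), Real.log (bern (C (z t) j) (g t j)) =
        ind (g t j) * Real.log (C i j) + (1 - ind (g t j)) * Real.log (1 - C i j) := by
      intro t ht
      rw [(Finset.mem_filter.1 ht).2, log_bern]
    rw [Finset.sum_congr rfl h, Finset.sum_add_distrib, ← Finset.sum_mul, ← Finset.sum_mul,
      Finset.sum_sub_distrib]
    have hA : (labelCount z i : ℝ) * Ahat g z i j =
        ∑ t ∈ Finset.univ.filter (fun t => z t = i), ind (g t j) := by
      unfold Ahat
      rw [← Finset.sum_filter]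
      -- For an unused label both sides vanish, whatever default value `Ahat` takes.
      by_cases hm : labelCount z i = 0
      · have : Finset.univ.filter (fun t => z t = i) = ∅ := Finset.card_eq_zero.1 hm
        simp [this]
      · have : (labelCount z i : ℝ) ≠ 0 := by exact_mod_cast hm
        field_simp
    rw [← hA, Finset.sum_const, nsmul_eq_mul, mul_one]
    change _ * _ + ((labelCount z i : ℝ) - _) * _ = _
    ring
  rw [profileLogLik_eq, key, key]
  exact Finset.sum_le_sum fun j _ => Finset.sum_le_sum fun i _ =>
    mul_le_mul_of_nonneg_left (mul_log_add_mul_log_le (Ahat_nonneg g z i j) (Ahat_le_one g z i j)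
      (h0 i j) (h1 i j)) (Nat.cast_nonneg _)

/-- Every term is the logarithm of a number at most `1`, so the hub columns can be dropped from an
upper bound. -/
lemma profileLogLik_le :
    profileLogLik g z ≤
      ∑ t, ∑ j : Fin n, if L ≤ (j : ℕ) then Real.log (bern (Ahat g z (z t) j) (g t j)) else 0 := by
  rw [profileLogLik_eq]
  refine Finset.sum_le_sum fun t _ => Finset.sum_le_sum fun j _ => ?_
  split_ifs
  · exact le_rfl
  · refine Real.log_nonpos (bern_Ahat_pos g z t j).le ?_
    have := Ahat_nonneg g z (z t) j
    have := Ahat_le_one g z (z t) j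
    cases g t j <;> simp only [bern, Bool.false_eq_true, if_true, if_false] <;> linarith

/-- The true hub columns contain entries `1`, which are not admissible in `le_profileLogLik`. They
are replaced by `1 / 2`, at a cost of `log 2` for each of at most `L` columns and each group. -/
lemma sub_le_profileLogLik {A : Fin (L + 1) → Fin n → ℝ}
    (h0 : ∀ i (j : Fin n), L ≤ (j : ℕ) → 0 < A i j)
    (h1 : ∀ i (j : Fin n), L ≤ (j : ℕ) → A i j < 1) :
    (∑ t, ∑ j : Fin n, if L ≤ (j : ℕ) then Real.log (bern (A (z t) j) (g t j)) else 0) -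
      T * (L * Real.log 2) ≤ profileLogLik g z := by
  refine le_trans ?_ (le_profileLogLik g z
    (B := fun i j => if L ≤ (j : ℕ) then A i j else 1 / 2) ?_ ?_)
  · rw [sub_le_iff_le_add]
    have hT : (T : ℝ) * (L * Real.log 2) = ∑ t : Fin T, (L : ℝ) * Real.log 2 := by simp
    rw [hT, ← Finset.sum_add_distrib]
    refine Finset.sum_le_sum fun t _ => ?_
    have hcard : ((Finset.univ.filter fun j : Fin n => ¬ L ≤ (j : ℕ)).card : ℝ) ≤ L := by
      have : (Finset.univ.filter fun j : Fin n => ¬ L ≤ (j : ℕ)).card ≤ (Finset.range L).card :=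
        Finset.card_le_card_of_injOn (fun j => (j : ℕ)) (by intro j; simp)
          (fun a _ b _ h => Fin.ext h)
      rw [Finset.card_range] at this
      exact_mod_cast this
    have h2 : ∑ j : Fin n, (if L ≤ (j : ℕ) then 0 else Real.log 2) ≤ L * Real.log 2 := by
      simp only [← ite_not (L ≤ _) (Real.log 2)]
      rw [← Finset.sum_filter, Finset.sum_const, nsmul_eq_mul]
      exact mul_le_mul_of_nonneg_right hcard (Real.log_nonneg (by norm_num))
    refine le_trans ?_ (add_le_add_right h2 _)
    rw [← Finset.sum_add_distrib]
    refine Finset.sum_le_sum fun j _ => ?_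
    split_ifs with h
    · simp
    · have : bern (1 / 2) (g t j) = 2⁻¹ := by cases g t j <;> norm_num [bern]
      rw [this, Real.log_inv]
      simp
  · intro i j; split_ifs with h
    · exact h0 i j h
    · norm_num
  · intro i j; split_ifs with h
    · exact h1 i j h
    · norm_num

end Ahat

/-! ### Likelihood comparison through Hellinger affinities -/

lemma sqrt_mul_add_sqrt_mul_le {a b : ℝ} (ha0 : 0 ≤ a) (ha1 : a ≤ 1) (hb0 : 0 ≤ b) (hb1 : b ≤ 1) :
    ∑ c, √(bern a c * bern b c) ≤ Real.exp (-((√a - √b) ^ 2 / 2)) := by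
  have h1 : √(a * b) = √a * √b := Real.sqrt_mul ha0 b
  have h2 : √((1 - a) * (1 - b)) = √(1 - a) * √(1 - b) := Real.sqrt_mul (sub_nonneg.2 ha1) _
  have e1 := Real.sq_sqrt ha0
  have e2 := Real.sq_sqrt hb0
  have e3 := Real.sq_sqrt (sub_nonneg.2 ha1)
  have e4 := Real.sq_sqrt (sub_nonneg.2 hb1)
  have h3 := Real.add_one_le_exp (-((√a - √b) ^ 2 / 2))
  simp only [Fintype.sum_bool, bern, if_true, Bool.false_eq_true, if_false, h1, h2]
  -- The affinity is `1` minus half the sum of the squared differences of the roots for both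
  -- outcomes; the second square is discarded.
  nlinarith [sq_nonneg (√(1 - a) - √(1 - b))]

/-- If the profile likelihood prefers `z` to the true labels, the conditional weight is at most a
multiple of the geometric mean of the true and the estimated likelihoods of the followers. -/
lemma condWeight_le {L n T : ℕ} {A : Fin (L + 1) → Fin n → ℝ} {ζ z : Fin T → Fin (L + 1)}
    {g : Fin T → Fin n → Bool} (hA0 : ∀ i j, 0 ≤ A i j) (hA1 : ∀ i j, A i j ≤ 1)
    (h0 : ∀ i (j : Fin n), L ≤ (j : ℕ) → 0 < A i j)
    (h1 : ∀ i (j : Fin n), L ≤ (j : ℕ) → A i j < 1)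
    (h : profileLogLik g ζ ≤ profileLogLik g z) :
    condWeight A ζ g ≤ Real.exp (T * (L * Real.log 2)) * ∏ t, ∏ j : Fin n,
      if L ≤ (j : ℕ) then √(bern (A (ζ t) j) (g t j) * bern (Ahat g z (z t) j) (g t j))
      else bern (A (ζ t) j) (g t j) := by
  set c := (T : ℝ) * (L * Real.log 2) with hc
  have hc0 : 0 ≤ c := by have := Real.log_nonneg (one_le_two (α := ℝ)); positivity
  have hbA : ∀ t j, 0 ≤ bern (A (ζ t) j) (g t j) := fun t j => bern_nonneg (hA0 _ _) (hA1 _ _) _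
  have hbApos : ∀ t (j : Fin n), L ≤ (j : ℕ) → 0 < bern (A (ζ t) j) (g t j) := by
    intro t j hj
    have := h0 (ζ t) j hj
    have := h1 (ζ t) j hj
    cases g t j <;> simp only [bern, Bool.false_eq_true, if_true, if_false] <;> linarith
  set Q := ∏ t, ∏ j : Fin n, (if L ≤ (j : ℕ) then 1 else bern (A (ζ t) j) (g t j)) with hQ
  set FA := ∏ t, ∏ j : Fin n, (if L ≤ (j : ℕ) then bern (A (ζ t) j) (g t j) else 1) with hFA
  set FB := ∏ t, ∏ j : Fin n, (if L ≤ (j : ℕ) then bern (Ahat g z (z t) j) (g t j) else 1) with hFB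
  have hw : condWeight A ζ g = Q * FA := by
    simp only [condWeight, hQ, hFA, ← Finset.prod_mul_distrib]
    refine Finset.prod_congr rfl fun t _ => Finset.prod_congr rfl fun j _ => ?_
    split_ifs <;> simp
  have hexp : ∀ f : Fin T → Fin n → ℝ, (∀ t (j : Fin n), L ≤ (j : ℕ) → 0 < f t j) →
      ∏ t, ∏ j : Fin n, (if L ≤ (j : ℕ) then f t j else 1) =
        Real.exp (∑ t, ∑ j : Fin n, if L ≤ (j : ℕ) then Real.log (f t j) else 0) := by
    intro f hf
    simp only [Real.exp_sum]
    refine Finset.prod_congr rfl fun t _ => Finset.prod_congr rfl fun j _ => ?_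
    split_ifs with hj
    · rw [Real.exp_log (hf t j hj)]
    · simp
  have hAB : FA ≤ Real.exp c * FB := by
    rw [hFA, hFB, hexp _ hbApos, hexp _ fun t j _ => bern_Ahat_pos g z t j, ← Real.exp_add,
      Real.exp_le_exp]
    linarith [sub_le_profileLogLik g ζ h0 h1, profileLogLik_le g z]
  have hFA0 : 0 ≤ FA := Finset.prod_nonneg fun t _ => Finset.prod_nonneg fun j _ => by
    split_ifs <;> simp [hbA]
  have hFB0 : 0 ≤ FB := Finset.prod_nonneg fun t _ => Finset.prod_nonneg fun j _ => by
    split_ifs <;> simp [(bern_Ahat_pos g z t j).le]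
  set R := ∏ t, ∏ j : Fin n,
      (if L ≤ (j : ℕ) then √(bern (A (ζ t) j) (g t j) * bern (Ahat g z (z t) j) (g t j))
      else bern (A (ζ t) j) (g t j)) with hR
  have hR0 : 0 ≤ R := Finset.prod_nonneg fun t _ => Finset.prod_nonneg fun j _ => by
    split_ifs
    · exact Real.sqrt_nonneg _
    · exact hbA t j
  have hR2 : R ^ 2 = Q ^ 2 * (FA * FB) := by
    simp only [hR, hQ, hFA, hFB, ← Finset.prod_pow, ← Finset.prod_mul_distrib]
    refine Finset.prod_congr rfl fun t _ => Finset.prod_congr rfl fun j _ => ?_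
    split_ifs
    · rw [Real.sq_sqrt (mul_nonneg (hbA t j) (bern_Ahat_pos g z t j).le)]; ring
    · ring
  rw [hw]
  -- In the square, one of the two factors `FA` is traded for `exp c * FB`, which creates the
  -- geometric mean; `√(exp c)` is enlarged to `exp c`.
  refine le_of_sq_le_sq ?_ (mul_nonneg (Real.exp_pos _).le hR0)
  have hexp1 : Real.exp c ≤ Real.exp c ^ 2 := by
    nlinarith [Real.one_le_exp hc0]
  calc (Q * FA) ^ 2 = Q ^ 2 * FA * FA := by ring
    _ ≤ Q ^ 2 * FA * (Real.exp c * FB) :=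
        mul_le_mul_of_nonneg_left hAB (mul_nonneg (sq_nonneg _) hFA0)
    _ = Real.exp c * (Q ^ 2 * (FA * FB)) := by ring
    _ ≤ Real.exp c ^ 2 * (Q ^ 2 * (FA * FB)) :=
        mul_le_mul_of_nonneg_right hexp1 (mul_nonneg (sq_nonneg _) (mul_nonneg hFA0 hFB0))
    _ = (Real.exp c * R) ^ 2 := by rw [mul_pow, hR2]

/-- The probability that the profile likelihood prefers a given assignment with given estimates to
the true labels. -/
lemma condProb_profileLogLik_le_of_Ahat_eq {L n T : ℕ} {A : Fin (L + 1) → Fin n → ℝ}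
    {ζ z : Fin T → Fin (L + 1)} {B : Fin (L + 1) → Fin n → ℝ}
    (hA0 : ∀ i j, 0 ≤ A i j) (hA1 : ∀ i j, A i j ≤ 1)
    (h0 : ∀ i (j : Fin n), L ≤ (j : ℕ) → 0 < A i j)
    (h1 : ∀ i (j : Fin n), L ≤ (j : ℕ) → A i j < 1)
    (hB0 : ∀ i j, 0 ≤ B i j) (hB1 : ∀ i j, B i j ≤ 1) :
    condProb A ζ {g | Ahat g z = B ∧ profileLogLik g ζ ≤ profileLogLik g z} ≤
      Real.exp (T * (L * Real.log 2)) * Real.exp (-((∑ t, ∑ j : Fin n,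
        if L ≤ (j : ℕ) then (√(A (ζ t) j) - √(B (z t) j)) ^ 2 else 0) / 2)) := by
  classical
  set f : Fin T → Fin n → Bool → ℝ := fun t j b => if L ≤ (j : ℕ) then
    √(bern (A (ζ t) j) b * bern (B (z t) j) b) else bern (A (ζ t) j) b with hf
  have hf0 : ∀ t j b, 0 ≤ f t j b := fun t j b => by
    simp only [hf]; split_ifs
    · positivity
    · exact bern_nonneg (hA0 _ _) (hA1 _ _) _
  -- With the estimate frozen at `B`, the bound is a product of functions of single entries, so its
  -- sum over all `g` factorises into affinities.
  calc _ ≤ ∑ g : Fin T → Fin n → Bool,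
        Real.exp (T * (L * Real.log 2)) * ∏ t, ∏ j, f t j (g t j) := by
        refine Finset.sum_le_sum fun g _ => ?_
        split_ifs with hg
        · have := condWeight_le hA0 hA1 h0 h1 hg.2
          rwa [hg.1] at this
        · exact mul_nonneg (Real.exp_pos _).le
            (Finset.prod_nonneg fun t _ => Finset.prod_nonneg fun j _ => hf0 _ _ _)
    _ = Real.exp (T * (L * Real.log 2)) * ∏ t, ∏ j, ∑ b, f t j b := by
        rw [← Finset.mul_sum, sum_prod_prod_apply]
    _ ≤ Real.exp (T * (L * Real.log 2)) * ∏ t, ∏ j : Fin n, Real.exp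
          (-((if L ≤ (j : ℕ) then (√(A (ζ t) j) - √(B (z t) j)) ^ 2 else 0) / 2)) := by
        refine mul_le_mul_of_nonneg_left ?_ (Real.exp_pos _).le
        refine Finset.prod_le_prod
          (fun t _ => Finset.prod_nonneg fun j _ => Finset.sum_nonneg fun b _ => hf0 _ _ _)
          fun t _ => Finset.prod_le_prod (fun j _ => Finset.sum_nonneg fun b _ => hf0 _ _ _)
          fun j _ => ?_
        simp only [hf]
        split_ifs
        · exact sqrt_mul_add_sqrt_mul_le (hA0 _ _) (hA1 _ _) (hB0 _ _) (hB1 _ _)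
        · rw [sum_bern]; simp
    _ = _ := by
        simp only [← Real.exp_sum, Finset.sum_neg_distrib, ← Finset.sum_div]

/-- The probability that the profile likelihood prefers some assignment in `Z` to the true labels,
when the assignments in `Z` are at squared Hellinger distance at least `H` from the truth. -/
lemma condProb_exists_profileLogLik_le {L n T : ℕ} {A : Fin (L + 1) → Fin n → ℝ}
    {ζ : Fin T → Fin (L + 1)} (hA0 : ∀ i j, 0 ≤ A i j) (hA1 : ∀ i j, A i j ≤ 1)
    (h0 : ∀ i (j : Fin n), L ≤ (j : ℕ) → 0 < A i j)
    (h1 : ∀ i (j : Fin n), L ≤ (j : ℕ) → A i j < 1) (Z : Set (Fin T → Fin (L + 1))) {H : ℝ}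
    (hZ : ∀ z ∈ Z, ∀ B : Fin (L + 1) → Fin n → ℝ, (∀ i j, 0 ≤ B i j) →
      H ≤ ∑ t, ∑ j : Fin n, if L ≤ (j : ℕ) then (√(A (ζ t) j) - √(B (z t) j)) ^ 2 else 0) :
    condProb A ζ {g | ∃ z ∈ Z, profileLogLik g ζ ≤ profileLogLik g z} ≤
      Real.exp (T * Real.log (L + 1) + 2 * n * (L + 1) * Real.log (T + 1) +
        T * (L * Real.log 2) - H / 2) := by
  classical
  -- Every value of `Ahat` is a quotient of two counts in `{0, …, T}`. The minimum with `1` keeps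
  -- the spurious pairs admissible, and division by `0` agrees with the default of `Ahat`.
  set B : (Fin (L + 1) → Fin n → Fin (T + 1) × Fin (T + 1)) → Fin (L + 1) → Fin n → ℝ :=
    fun q i j => min 1 (((q i j).1 : ℕ) / ((q i j).2 : ℕ) : ℝ) with hB
  have hB0 : ∀ q i j, 0 ≤ B q i j := fun q i j => le_min zero_le_one (by positivity)
  have hB1 : ∀ q i j, B q i j ≤ 1 := fun q i j => min_le_left _ _
  have hcover : ∀ g : Fin T → Fin n → Bool, ∀ z : Fin T → Fin (L + 1), ∃ q, Ahat g z = B q := by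
    intro g z
    have hT : ∀ i, labelCount z i ≤ T := fun i => by
      simpa [labelCount] using Finset.card_filter_le (Finset.univ : Finset (Fin T)) (z · = i)
    refine ⟨fun i j => (⟨(Finset.univ.filter fun t => z t = i ∧ g t j = true).card,
      Nat.lt_succ_of_le ((card_filter_le_labelCount g z i j).trans (hT i))⟩,
      ⟨labelCount z i, Nat.lt_succ_of_le (hT i)⟩), ?_⟩
    funext i j
    simp only [hB]
    rw [← Ahat_eq_card_div, min_eq_right (Ahat_le_one g z i j)]
  set S : (Fin T → Fin (L + 1)) × (Fin (L + 1) → Fin n → Fin (T + 1) × Fin (T + 1)) →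
    Set (Fin T → Fin n → Bool) := fun p =>
      {g | p.1 ∈ Z ∧ Ahat g p.1 = B p.2 ∧ profileLogLik g ζ ≤ profileLogLik g p.1} with hS
  have hSb : ∀ p, condProb A ζ (S p) ≤ Real.exp (T * (L * Real.log 2)) * Real.exp (-(H / 2)) := by
    intro p
    by_cases hp : p.1 ∈ Z
    · refine (condProb_mono hA0 hA1 (S' := {g | Ahat g p.1 = B p.2 ∧
        profileLogLik g ζ ≤ profileLogLik g p.1}) fun g hg _ => hg.2).trans ?_
      refine (condProb_profileLogLik_le_of_Ahat_eq hA0 hA1 h0 h1 (hB0 p.2) (hB1 p.2)).trans ?_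
      refine mul_le_mul_of_nonneg_left (Real.exp_le_exp.2 ?_) (Real.exp_pos _).le
      linarith [hZ p.1 hp (B p.2) (hB0 p.2)]
    · have : condProb A ζ (S p) = 0 := by simp [condProb, hS, hp]
      rw [this]; positivity
  refine (condProb_mono hA0 hA1 (S' := ⋃ p, S p) ?_).trans
    ((condProb_iUnion_le hA0 hA1 S hSb).trans (le_of_eq ?_))
  · rintro g ⟨z, hz, hg⟩ _
    obtain ⟨q, hq⟩ := hcover g z
    exact Set.mem_iUnion.2 ⟨(z, q), hz, hq, hg⟩
  · have hL : ((L : ℝ) + 1) ^ T = Real.exp (T * Real.log (L + 1)) := by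
      rw [Real.exp_nat_mul, Real.exp_log (by positivity)]
    have hT : (((T : ℝ) + 1) * (T + 1)) ^ (n * (L + 1)) =
        Real.exp (2 * n * (L + 1) * Real.log (T + 1)) := by
      rw [← pow_two, ← pow_mul, ← Real.exp_log (show (0 : ℝ) < T + 1 by positivity),
        ← Real.exp_nat_mul, Real.log_exp]
      congr 1; push_cast; ring
    have hc : (Fintype.card ((Fin T → Fin (L + 1)) ×
        (Fin (L + 1) → Fin n → Fin (T + 1) × Fin (T + 1))) : ℝ) =
        ((L : ℝ) + 1) ^ T * (((T : ℝ) + 1) * (T + 1)) ^ (n * (L + 1)) := by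
      simp [pow_mul]
    rw [hc, hL, hT, ← Real.exp_add, ← Real.exp_add, ← Real.exp_add]
    congr 1; ring

/-! ### Hellinger separation when hub groups join the null class -/

section Separation

variable {L n T : ℕ} {s A : Fin (L + 1) → Fin n → ℝ} {v τ smin smax d : ℝ}

/-- The preferring followers of distinct hubs form disjoint sets. -/
lemma SeparatedHubs.exists_disjoint (h : SeparatedHubs v τ s) (hτ : 0 < τ) :
    ∃ W : Fin (L + 1) → Finset (Fin n), (∀ i i', i ≠ i' → Disjoint (W i) (W i')) ∧
      (∀ i, ∀ j ∈ W i, L ≤ (j : ℕ)) ∧ (∀ i, i ≠ 0 → v * n / L ≤ ((W i).card : ℝ)) ∧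
      ∀ i, ∀ j ∈ W i, i ≠ 0 ∧ τ ≤ s i j - s 0 j := by
  choose V hV using h
  have key : ∀ i, ∀ j ∈ (if h : i ≠ 0 then V i h else ∅), ∃ h : i ≠ 0, j ∈ V i h := by
    intro i j hj
    split_ifs at hj with h
    · exact ⟨h, hj⟩
    · simp at hj
  refine ⟨fun i => if h : i ≠ 0 then V i h else ∅, ?_, ?_, ?_, ?_⟩
  · intro i i' hne
    rw [Finset.disjoint_left]
    intro j hj hj'
    obtain ⟨h, hj⟩ := key i j hj
    obtain ⟨h', hj'⟩ := key i' j hj'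
    have h1 := (hV i h).2.2 j hj i' hne.symm
    have h2 := (hV i' h').2.2 j hj' i hne
    linarith
  · intro i j hj
    obtain ⟨h, hj⟩ := key i j hj
    exact (hV i h).1 j hj
  · intro i hi
    simp only [dif_pos hi]
    exact (hV i hi).2.1
  · intro i j hj
    obtain ⟨h, hj⟩ := key i j hj
    exact ⟨h, (hV i h).2.2 j hj 0 h.symm⟩

/-- The `L` disjoint sets of at least `v n / L` followers fit into `n` nodes. This lets `v ^ 2` be
replaced by `v` in the rates. -/
lemma SeparatedHubs.le_one (h : SeparatedHubs v τ s) (hτ : 0 < τ) (hL : 0 < L) (hn : 0 < n) :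
    v ≤ 1 := by
  obtain ⟨W, hd, -, hc, -⟩ := h.exists_disjoint hτ
  have h1 : ∑ i ∈ Finset.univ.erase (0 : Fin (L + 1)), v * n / L ≤
      ∑ i ∈ Finset.univ.erase (0 : Fin (L + 1)), ((W i).card : ℝ) :=
    Finset.sum_le_sum fun i hi => hc i (Finset.ne_of_mem_erase hi)
  have h2 : ∑ i ∈ Finset.univ.erase (0 : Fin (L + 1)), (W i).card ≤ n := by
    rw [← Finset.card_biUnion fun i _ i' _ => hd i i']
    simpa using Finset.card_le_univ (α := Fin n) _
  have h3 : ∑ i ∈ Finset.univ.erase (0 : Fin (L + 1)), ((W i).card : ℝ) ≤ n := by exact_mod_cast h2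
  have hL' : (0 : ℝ) < L := by exact_mod_cast hL
  have hn' : (0 : ℝ) < n := by exact_mod_cast hn
  have h4 : ∑ i ∈ Finset.univ.erase (0 : Fin (L + 1)), v * n / L = v * n := by
    rw [Finset.sum_const, Finset.card_erase_of_mem (Finset.mem_univ _)]
    simp
    field_simp
  nlinarith

/-- Factor `b - a = (√b - √a) (√b + √a)` and bound the second factor by `2 √(smax * d)`. The result
is of order `d`, whereas the squared difference of the entries themselves would only give `d ^ 2`.
-/
lemma le_sq_sqrt_sub_sqrt {a b : ℝ} (ha : 0 ≤ a) (hs : 0 < smax) (hd : 0 < d) (hτ : 0 ≤ τ)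
    (hb : b ≤ smax * d) (hab : τ * d ≤ b - a) : τ ^ 2 * d / (4 * smax) ≤ (√b - √a) ^ 2 := by
  have hb0 : 0 ≤ b := by nlinarith
  have e1 := Real.sq_sqrt ha
  have e2 := Real.sq_sqrt hb0
  have hle : √a ≤ √b := Real.sqrt_le_sqrt (by nlinarith)
  have h1 : τ * d ≤ (√b - √a) * (2 * √b) := by nlinarith [Real.sqrt_nonneg a]
  have h2 : (τ * d) ^ 2 ≤ ((√b - √a) * (2 * √b)) ^ 2 := pow_le_pow_left₀ (by positivity) h1 2
  have h3 : ((√b - √a) * (2 * √b)) ^ 2 ≤ (√b - √a) ^ 2 * (4 * smax * d) := by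
    have : ((√b - √a) * (2 * √b)) ^ 2 = (√b - √a) ^ 2 * (4 * √b ^ 2) := by ring
    rw [this, e2]
    exact mul_le_mul_of_nonneg_left (by linarith) (sq_nonneg _)
  rw [div_le_iff₀ (by positivity)]
  have h4 : τ ^ 2 * d * d ≤ (√b - √a) ^ 2 * (4 * smax) * d := by nlinarith
  exact le_of_mul_le_mul_right h4 hd

/-- An assignment that labels by `0` many hubless groups and some hub groups is at a large
squared Hellinger distance from the truth. -/
lemma le_sum_sq_sqrt_sub_sqrt (hA0 : ∀ i j, 0 ≤ A i j) (hs : 0 < smax) (hd : 0 < d) (hτ : 0 < τ)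
    (hsA : ScaledEntries smin smax d s A) (hsep : SeparatedHubs v τ s) {ζ z : Fin T → Fin (L + 1)}
    {θ C : ℝ} (hθ0 : 0 < θ) (hθ1 : θ ≤ 1) (hC : ∀ i, (labelCount ζ i : ℝ) ≤ C)
    (h0 : θ * C ≤ ((Finset.univ.filter fun t => ζ t = 0 ∧ z t = 0).card : ℝ))
    (B : Fin (L + 1) → Fin n → ℝ) :
    v * n / L * ((Finset.univ.filter fun t => ζ t ≠ 0 ∧ z t = 0).card : ℝ) *
        (θ * τ ^ 2 * d / (8 * smax)) ≤
      ∑ t, ∑ j : Fin n, if L ≤ (j : ℕ) then (√(A (ζ t) j) - √(B (z t) j)) ^ 2 else 0 := by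
  obtain ⟨W, hdisj, hW, hc, hgap⟩ := hsep.exists_disjoint hτ
  set N : Fin (L + 1) → ℝ := fun i => ((Finset.univ.filter fun t => ζ t = i ∧ z t = 0).card : ℝ)
    with hN
  set κ := θ * τ ^ 2 * d / (8 * smax) with hκ
  have hκ0 : 0 ≤ κ := by positivity
  have hN0 : ∀ i, 0 ≤ N i := fun i => Nat.cast_nonneg _
  -- The null groups kept in class `0` outnumber, up to the factor `θ`, those received from any
  -- single hub.
  have hNC : ∀ i, θ * N i ≤ N 0 := fun i => by
    refine le_trans (mul_le_mul_of_nonneg_left (le_trans ?_ (hC i)) hθ0.le) h0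
    simp only [hN]
    exact_mod_cast Finset.card_le_card
      (Finset.monotone_filter_right (p := fun t => ζ t = i ∧ z t = 0) _ fun _ _ h => h.1)
  -- In column `j` the same `B 0 j` serves the labels `0` and `i`: `N 0 * x² + N i * y² ≥ θ * N i *
  -- (x² + y²) ≥ θ * N i * (y - x)² / 2`, and `y - x` does not involve `B`.
  have hcol : ∀ i, ∀ j ∈ W i, N i * κ ≤ ∑ t, (√(A (ζ t) j) - √(B (z t) j)) ^ 2 := by
    intro i j hj
    obtain ⟨hi, hτj⟩ := hgap i j hj
    have hfol := hW i j hj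
    have hnh : ∀ i' : Fin (L + 1), ¬ IsHubOf i' j := fun i' h => by
      have h' := i'.isLt
      change (i' : ℕ) = (j : ℕ) + 1 at h
      change L ≤ (j : ℕ) at hfol
      omega
    have hAi := hsA i j (hnh i)
    have hAz := hsA 0 j (hnh 0)
    set x := √(A 0 j) - √(B 0 j)
    set y := √(A i j) - √(B 0 j)
    have hxy : τ ^ 2 * d / (4 * smax) ≤ (y - x) ^ 2 := by
      have := le_sq_sqrt_sub_sqrt (b := A i j) (hA0 0 j) hs hd hτ.le
        (by rw [hAi.1]; nlinarith [hAi.2.2]) (by rw [hAi.1, hAz.1]; nlinarith)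
      calc _ ≤ _ := this
        _ = _ := by simp only [x, y]; ring
    have hfib : ∀ i', ∑ t ∈ Finset.univ.filter (fun t => ζ t = i' ∧ z t = 0),
        (√(A (ζ t) j) - √(B (z t) j)) ^ 2 = N i' * (√(A i' j) - √(B 0 j)) ^ 2 := by
      intro i'
      rw [hN, ← nsmul_eq_mul, ← Finset.sum_const]
      refine Finset.sum_congr rfl fun t ht => ?_
      rw [(Finset.mem_filter.1 ht).2.1, (Finset.mem_filter.1 ht).2.2]
    have hsub : N 0 * x ^ 2 + N i * y ^ 2 ≤ ∑ t, (√(A (ζ t) j) - √(B (z t) j)) ^ 2 := by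
      rw [← hfib 0, ← hfib i, ← Finset.sum_union]
      · exact Finset.sum_le_sum_of_subset_of_nonneg (Finset.subset_univ _)
          fun _ _ _ => sq_nonneg _
      · rw [Finset.disjoint_left]
        intro t ht ht'
        simp only [Finset.mem_filter, Finset.mem_univ, true_and] at ht ht'
        exact hi (ht'.1.symm.trans ht.1)
    refine le_trans ?_ hsub
    have e1 : θ * N i * x ^ 2 ≤ N 0 * x ^ 2 := mul_le_mul_of_nonneg_right (hNC i) (sq_nonneg _)
    have e2 : θ * N i * y ^ 2 ≤ N i * y ^ 2 :=
      mul_le_mul_of_nonneg_right (by nlinarith [hN0 i]) (sq_nonneg _)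
    have e3 : (y - x) ^ 2 ≤ 2 * (x ^ 2 + y ^ 2) := by nlinarith [sq_nonneg (x + y)]
    have e4 : θ * N i / 2 * (τ ^ 2 * d / (4 * smax)) ≤ θ * N i / 2 * (2 * (x ^ 2 + y ^ 2)) :=
      mul_le_mul_of_nonneg_left (hxy.trans e3) (by have := hN0 i; positivity)
    have e5 : N i * κ = θ * N i / 2 * (τ ^ 2 * d / (4 * smax)) := by
      rw [hκ]; field_simp; ring
    linarith
  have hN0sum : ((Finset.univ.filter fun t => ζ t ≠ 0 ∧ z t = 0).card : ℝ) =
      ∑ i ∈ Finset.univ.erase (0 : Fin (L + 1)), N i := by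
    have : (Finset.univ.filter fun t => ζ t ≠ 0 ∧ z t = 0) =
        (Finset.univ.erase (0 : Fin (L + 1))).biUnion
          fun i => Finset.univ.filter fun t => ζ t = i ∧ z t = 0 := by
      ext t; simp
    rw [this, Finset.card_biUnion]
    · simp [hN]
    · intro i _ i' _ hne
      rw [Function.onFun, Finset.disjoint_left]
      intro t ht ht'
      simp only [Finset.mem_filter, Finset.mem_univ, true_and] at ht ht'
      exact hne (ht.1.symm.trans ht'.1)
  calc _ = ∑ i ∈ Finset.univ.erase (0 : Fin (L + 1)), v * n / L * (N i * κ) := by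
        rw [hN0sum, Finset.mul_sum, Finset.sum_mul]
        exact Finset.sum_congr rfl fun i _ => by ring
    _ ≤ ∑ i ∈ Finset.univ.erase (0 : Fin (L + 1)), ∑ j ∈ W i,
          ∑ t, (√(A (ζ t) j) - √(B (z t) j)) ^ 2 := by
        refine Finset.sum_le_sum fun i hi => ?_
        refine (mul_le_mul_of_nonneg_right (hc i (Finset.ne_of_mem_erase hi))
          (mul_nonneg (hN0 i) hκ0)).trans ?_
        rw [← nsmul_eq_mul, ← Finset.sum_const]
        exact Finset.sum_le_sum (hcol i)
    _ = ∑ j ∈ (Finset.univ.erase (0 : Fin (L + 1))).biUnion W,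
          ∑ t, (√(A (ζ t) j) - √(B (z t) j)) ^ 2 :=
        (Finset.sum_biUnion fun i _ i' _ => hdisj i i').symm
    _ ≤ ∑ j ∈ Finset.univ.filter (fun j : Fin n => L ≤ (j : ℕ)),
          ∑ t, (√(A (ζ t) j) - √(B (z t) j)) ^ 2 := by
        refine Finset.sum_le_sum_of_subset_of_nonneg ?_
          fun _ _ _ => Finset.sum_nonneg fun _ _ => sq_nonneg _
        intro j hj
        obtain ⟨i, -, hj⟩ := Finset.mem_biUnion.1 hj
        simpa using hW i j hj
    _ = _ := by rw [Finset.sum_comm]; simp only [Finset.sum_filter]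

end Separation

/-! ### Exponential tails for counts of groups -/

section Tails

variable {L n T : ℕ} {A : Fin (L + 1) → Fin n → ℝ} {ζ : Fin T → Fin (L + 1)}

open Classical in
lemma sum_sum_prod_bern (p : Fin (L + 1) → Prop) [DecidablePred p] (S : Finset (Fin n)) (b : Bool)
    {E : Fin T → Set (Fin n → Bool)} (hE : ∀ t x, x ∈ E t ↔ p (ζ t) ∧ ∀ j ∈ S, x j = b) :
    (∑ t, ∑ x : Fin n → Bool, if x ∈ E t then ∏ j, bern (A (ζ t) j) (x j) else 0) =
    ∑ t, if p (ζ t) then ∏ j ∈ S, bern (A (ζ t) j) b else 0 := by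
  refine Finset.sum_congr rfl fun t _ => ?_
  simp only [hE]
  by_cases h : p (ζ t)
  · simp only [h, true_and, if_true, ← sum_prod_bern_of_forall]
  · simp [h]

/-- Chernoff's bound at `l = 1`, with `e - 1 ≤ 2`. -/
lemma condProb_le_card_le (h0 : ∀ i j, 0 ≤ A i j) (h1 : ∀ i j, A i j ≤ 1)
    (p : Fin (L + 1) → Prop) [DecidablePred p] (S : Finset (Fin n)) (b : Bool) {a M : ℝ}
    (hM : ∑ t, (if p (ζ t) then ∏ j ∈ S, bern (A (ζ t) j) b else 0) ≤ M) :
    condProb A ζ {g | a ≤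
      ((Finset.univ.filter fun t => p (ζ t) ∧ ∀ j ∈ S, g t j = b).card : ℝ)} ≤
      Real.exp (-a + 2 * M) := by
  classical
  refine (condProb_count_le h0 h1 (fun t => {x | p (ζ t) ∧ ∀ j ∈ S, x j = b}) 1 a _ ?_).trans
    (Real.exp_le_exp.2 ?_)
  · intro g hg
    rw [Set.mem_ofPred_eq] at hg
    rw [one_mul, sub_nonneg]
    convert hg using 4
    exact Iff.rfl
  · rw [sum_sum_prod_bern p S b (E := fun t => {x | p (ζ t) ∧ ∀ j ∈ S, x j = b}) fun _ _ => Iff.rfl]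
    have hpos : 0 ≤ ∑ t, (if p (ζ t) then ∏ j ∈ S, bern (A (ζ t) j) b else 0) :=
      Finset.sum_nonneg fun t _ => by
        split_ifs
        · exact Finset.prod_nonneg fun j _ => bern_nonneg (h0 _ _) (h1 _ _) _
        · exact le_rfl
    nlinarith [Real.exp_one_lt_three]

/-- Chernoff's bound at `l = -1`, with `1 - e⁻¹ ≥ 1 / 2`. -/
lemma condProb_card_le_le (h0 : ∀ i j, 0 ≤ A i j) (h1 : ∀ i j, A i j ≤ 1)
    (p : Fin (L + 1) → Prop) [DecidablePred p] (S : Finset (Fin n)) (b : Bool) {a M : ℝ} (hM0 : 0 ≤ M)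
    (hM : M ≤ ∑ t, (if p (ζ t) then ∏ j ∈ S, bern (A (ζ t) j) b else 0)) :
    condProb A ζ {g |
      ((Finset.univ.filter fun t => p (ζ t) ∧ ∀ j ∈ S, g t j = b).card : ℝ) ≤ a} ≤
      Real.exp (a - M / 2) := by
  classical
  refine (condProb_count_le h0 h1 (fun t => {x | p (ζ t) ∧ ∀ j ∈ S, x j = b}) (-1) a _ ?_).trans
    (Real.exp_le_exp.2 ?_)
  · intro g hg
    rw [Set.mem_ofPred_eq] at hg
    rw [neg_one_mul, neg_nonneg, sub_nonpos]
    convert hg using 4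
    exact Iff.rfl
  · rw [sum_sum_prod_bern p S b (E := fun t => {x | p (ζ t) ∧ ∀ j ∈ S, x j = b}) fun _ _ => Iff.rfl]
    have he : Real.exp (-1) ≤ 1 / 2 := by
      rw [Real.exp_neg, one_div]
      exact inv_anti₀ (by norm_num) (by linarith [Real.exp_one_gt_d9])
    nlinarith

end Tails

/-! ### The deterministic deduction -/

/-- The nodes of the hub set other than the hub with label `i`. -/
def foreignHubs {L : ℕ} (n : ℕ) (i : Fin (L + 1)) : Finset (Fin n) :=
  Finset.univ.filter fun j => (j : ℕ) < L ∧ (i : ℕ) ≠ (j : ℕ) + 1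

lemma exists_isHubOf {L n : ℕ} (hLn : L < n) {i : Fin (L + 1)} (hi : i ≠ 0) :
    ∃ j : Fin n, IsHubOf i j ∧ (j : ℕ) < L := by
  have h1 := i.isLt
  have h2 : (i : ℕ) ≠ 0 := fun h => hi (Fin.ext h)
  exact ⟨⟨i - 1, by omega⟩, by simp only [IsHubOf]; omega, by simp only; omega⟩

/-- A hub missing from its own group contributes a factor `0`. This makes the true labels a
legitimate competitor of the maximizer. -/
lemma feasible_of_condWeight_ne_zero {L n T : ℕ} {A : Fin (L + 1) → Fin n → ℝ}
    (hub : ∀ i j, IsHubOf i j → A i j = 1) {ζ : Fin T → Fin (L + 1)} {g : Fin T → Fin n → Bool}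
    (h : condWeight A ζ g ≠ 0) : Feasible g ζ := by
  intro t j hj
  by_contra hg
  refine h (Finset.prod_eq_zero (Finset.mem_univ t) (Finset.prod_eq_zero (Finset.mem_univ j) ?_))
  simp [hub _ _ hj, bern, hg]

/-- On a favourable sample every maximum profile likelihood estimate yields small errors. -/
lemma maxError_lt {L n T : ℕ} (hLn : L < n) {A : Fin (L + 1) → Fin n → ℝ}
    (hA0 : ∀ i j, 0 ≤ A i j) (hub : ∀ i j, IsHubOf i j → A i j = 1)
    {g : Fin T → Fin n → Bool} {ζ z : Fin T → Fin (L + 1)} (hζ : Feasible g ζ) (hz : IsMPLE g z)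
    {m η ε : ℝ} (hη : 0 < η) (hηm : 2 * η ≤ m) (hε : 4 * η ≤ ε * m)
    (hAε : ∀ i j, ¬ IsHubOf i j → A i j < ε)
    (h2 : ∀ i, m < ((Finset.univ.filter fun t =>
      ζ t = i ∧ ∀ j ∈ foreignHubs n i, g t j = false).card : ℝ))
    (h3 : ∀ i j, ¬ IsHubOf i j →
      ((Finset.univ.filter fun t => ζ t = i ∧ g t j = true).card : ℝ) < η)
    (h4 : ∀ i h j, IsHubOf i h → j ≠ h →
      ((Finset.univ.filter fun t => ζ t ≠ i ∧ g t h = true ∧ g t j = true).card : ℝ) < η)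
    (h5 : m ≤ ((Finset.univ.filter fun t => ζ t = 0 ∧ z t = 0).card : ℝ) →
      η ≤ ((Finset.univ.filter fun t => ζ t ≠ 0 ∧ z t = 0).card : ℝ) →
      profileLogLik g z < profileLogLik g ζ) :
    maxError A g z < ε := by
  have hle : ∀ {p q : Fin T → Prop} [DecidablePred p] [DecidablePred q], (∀ t, p t → q t) →
      ((Finset.univ.filter p).card : ℝ) ≤ ((Finset.univ.filter q).card : ℝ) := by
    intro p q _ _ h
    exact_mod_cast Finset.card_le_card (Finset.monotone_filter_right _ fun t _ => h t)
  have hle2 : ∀ {p q r : Fin T → Prop} [DecidablePred p] [DecidablePred q] [DecidablePred r],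
      (∀ t, p t → q t ∨ r t) → ((Finset.univ.filter p).card : ℝ) ≤
        ((Finset.univ.filter q).card : ℝ) + ((Finset.univ.filter r).card : ℝ) := by
    intro p q r _ _ _ h
    have := (hle (p := p) (q := fun t => q t ∨ r t) h)
    rw [Finset.filter_or] at this
    exact this.trans (by exact_mod_cast Finset.card_union_le _ _)
  -- Any third label would require its own hub, which is foreign to `i`, to be present.
  have hforeign : ∀ i t, (∀ j ∈ foreignHubs n i, g t j = false) → z t = 0 ∨ z t = i := by
    intro i t h
    by_contra! hne
    obtain ⟨j, hj, hjL⟩ := exists_isHubOf hLn hne.1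
    have h1 := hz.1 t j hj
    have h2 := h j (by
      simp only [foreignHubs, Finset.mem_filter, Finset.mem_univ, true_and]
      exact ⟨hjL, fun hi => hne.2 (Fin.ext (Eq.trans hj hi.symm))⟩)
    rw [h1] at h2
    cases h2
  have hm0 : m < ((Finset.univ.filter fun t => ζ t = 0 ∧ z t = 0).card : ℝ) :=
    (h2 0).trans_le (hle fun t h => ⟨h.1, (hforeign 0 t h.2).elim id id⟩)
  -- Otherwise `h5` makes the true labels strictly better than the maximizer `z`.
  have hN0 : ((Finset.univ.filter fun t => ζ t ≠ 0 ∧ z t = 0).card : ℝ) < η := by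
    by_contra! h
    exact (h5 hm0.le h).not_ge (hz.2 ζ hζ)
  have hcount : ∀ i, m - η < (labelCount z i : ℝ) := by
    intro i
    by_cases hi : i = 0
    · subst hi
      have := hle (p := fun t => ζ t = 0 ∧ z t = 0) (q := fun t => z t = 0) fun t h => h.2
      unfold labelCount
      linarith
    · have := hle2 (p := fun t => ζ t = i ∧ ∀ j ∈ foreignHubs n i, g t j = false)
        (q := fun t => z t = i) (r := fun t => ζ t ≠ 0 ∧ z t = 0) fun t h =>
          (hforeign i t h.2).symm.imp id fun h0 => ⟨by rw [h.1]; exact hi, h0⟩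
      have := h2 i
      unfold labelCount
      linarith
  have hent : ∀ i j, |Ahat g z i j - A i j| < ε := by
    intro i j
    have hci := hcount i
    have hpos : (0 : ℝ) < labelCount z i := by linarith
    have hε0 : 0 < ε := by
      by_contra! h
      nlinarith
    by_cases hij : IsHubOf i j
    · have : Ahat g z i j = 1 := by
        rw [Ahat_eq_card_div, div_eq_one_iff_eq hpos.ne', labelCount]
        congr 2
        ext t
        simp only [Finset.mem_filter, Finset.mem_univ, true_and, and_iff_left_iff_imp]
        rintro rfl
        exact hz.1 t j hij
      rw [this, hub i j hij]
      simpa using hε0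
    -- Groups truly in class `i` contribute less than `η`. The intruders also contribute less than
    -- `η`: for `i = 0` by `hN0`, and for a hub label because they contain both that hub and `j`.
    · have hnum : ((Finset.univ.filter fun t => z t = i ∧ g t j = true).card : ℝ) < 2 * η := by
        have h3' := h3 i j hij
        by_cases hi : i = 0
        · subst hi
          have := hle2 (p := fun t => z t = 0 ∧ g t j = true)
            (q := fun t => ζ t = 0 ∧ g t j = true) (r := fun t => ζ t ≠ 0 ∧ z t = 0) fun t h => by
              by_cases h0 : ζ t = 0
              · exact Or.inl ⟨h0, h.2⟩
              · exact Or.inr ⟨h0, h.1⟩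
          linarith
        · obtain ⟨h, hh, -⟩ := exists_isHubOf hLn hi
          have := hle2 (p := fun t => z t = i ∧ g t j = true)
            (q := fun t => ζ t = i ∧ g t j = true)
            (r := fun t => ζ t ≠ i ∧ g t h = true ∧ g t j = true) fun t ht => by
              by_cases h0 : ζ t = i
              · exact Or.inl ⟨h0, ht.2⟩
              · exact Or.inr ⟨h0, hz.1 t h (by rw [ht.1]; exact hh), ht.2⟩
          have h4' := h4 i h j hh (by rintro rfl; exact hij hh)
          linarith
      -- The class has more than `m - η ≥ m / 2` members, and `2 * η ≤ ε * m / 2`.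
      have h1 : Ahat g z i j < ε := by
        rw [Ahat_eq_card_div, div_lt_iff₀ hpos]
        nlinarith
      -- Estimate and truth both lie in `[0, ε)`.
      rw [abs_lt]
      constructor <;> linarith [hA0 i j, hAε i j hij, Ahat_nonneg g z i j]
  have : Nonempty (Fin (L + 1) × Fin n) := ⟨(0, ⟨0, by omega⟩)⟩
  obtain ⟨p, hp⟩ := exists_eq_ciSup_of_finite
    (f := fun p : Fin (L + 1) × Fin n => |Ahat g z p.1 p.2 - A p.1 p.2|)
  rw [maxError, ← hp]
  exact hent _ _

lemma exp_neg_two_mul_le {y : ℝ} (h0 : 0 ≤ y) (h1 : y ≤ 1 / 2) : Real.exp (-(2 * y)) ≤ 1 - y := by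
  rw [Real.exp_neg]
  refine inv_le_of_inv_le₀ (by linarith) ?_
  have h2 : (1 - y)⁻¹ ≤ 2 * y + 1 := by
    rw [inv_le_iff_one_le_mul₀ (by linarith)]
    nlinarith
  exact h2.trans (Real.add_one_le_exp _)

/-! ### Bounds for fixed balanced labels -/

section FiniteSample

variable {L n T : ℕ} {s A : Fin (L + 1) → Fin n → ℝ} {ζ : Fin T → Fin (L + 1)}
  {smin smax d v τ c₀ cmin cmax κ η θ ε β R : ℝ}

/-- The probability that a group formed by `i` contains no foreign hub is bounded below. -/
lemma exp_le_prod_foreignHubs (hL : 0 < L) (hc₀ : 0 < c₀) (hc₀L : 2 * c₀ ≤ L)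
    (H4 : RareHubs c₀ A) (i : Fin (L + 1)) :
    Real.exp (-(2 * c₀)) ≤ ∏ j ∈ foreignHubs n i, bern (A i j) false := by
  have hL' : (0 : ℝ) < L := by exact_mod_cast hL
  have hcard : (foreignHubs n i).card ≤ L := by
    have : (foreignHubs n i).card ≤ (Finset.range L).card :=
      Finset.card_le_card_of_injOn (fun j => (j : ℕ)) (by intro j; simp +contextual [foreignHubs])
        (fun a _ b _ h => Fin.ext h)
    simpa using this
  have hcard' : ((foreignHubs n i).card : ℝ) ≤ L := by exact_mod_cast hcard
  calc Real.exp (-(2 * c₀)) ≤ Real.exp ((foreignHubs n i).card * (-(2 * (c₀ / L)))) := by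
        rw [Real.exp_le_exp]
        have : 2 * c₀ = L * (2 * (c₀ / L)) := by field_simp
        have h2 : 0 ≤ 2 * (c₀ / L) := by positivity
        nlinarith
    _ = ∏ j ∈ foreignHubs n i, Real.exp (-(2 * (c₀ / L))) := by
        rw [Finset.prod_const, Real.exp_nat_mul]
    _ ≤ _ := by
        refine Finset.prod_le_prod (fun _ _ => (Real.exp_pos _).le) fun j hj => ?_
        simp only [foreignHubs, Finset.mem_filter, Finset.mem_univ, true_and] at hj
        have h1 : A i j ≤ c₀ / L := H4 i j (not_le.2 hj.1) hj.2
        have h2 : c₀ / L ≤ 1 / 2 := by rw [div_le_iff₀ hL']; linarith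
        refine (exp_neg_two_mul_le (by positivity) h2).trans ?_
        simp only [bern, Bool.false_eq_true, if_false]
        linarith

lemma condProb_card_foreignHubs_le (hA0 : ∀ i j, 0 ≤ A i j) (hA1 : ∀ i j, A i j ≤ 1)
    (hL : 0 < L) (hc₀ : 0 < c₀) (hc₀L : 2 * c₀ ≤ L) (H4 : RareHubs c₀ A) (hR : 0 ≤ R)
    (hκ0 : 0 ≤ κ) (hκ : 4 * κ ≤ cmin * Real.exp (-(2 * c₀))) (i : Fin (L + 1))
    (hbal : R * cmin ≤ labelCount ζ i) :
    condProb A ζ {g | ((Finset.univ.filter fun t =>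
      ζ t = i ∧ ∀ j ∈ foreignHubs n i, g t j = false).card : ℝ) ≤ κ * R} ≤
      Real.exp (-(κ * R)) := by
  classical
  -- The mean is at least `4 * κ * R`, which leaves the exponent `κ * R - 2 * κ * R`.
  have h := condProb_card_le_le (ζ := ζ) hA0 hA1 (fun i' => i' = i) (foreignHubs n i) false
    (a := κ * R) (M := 4 * (κ * R)) (by positivity) ?_
  · refine (condProb_mono hA0 hA1 ?_).trans (h.trans (Real.exp_le_exp.2 (by linarith)))
    intro g hg _
    rw [Set.mem_ofPred_eq] at hg ⊢
    convert hg using 4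
  · have hsum : ∑ t, (if ζ t = i then ∏ j ∈ foreignHubs n i, bern (A (ζ t) j) false else 0) =
        labelCount ζ i * ∏ j ∈ foreignHubs n i, bern (A i j) false := by
      rw [← Finset.sum_filter, labelCount, ← nsmul_eq_mul, ← Finset.sum_const]
      refine Finset.sum_congr rfl fun t ht => ?_
      rw [(Finset.mem_filter.1 ht).2]
    rw [hsum]
    calc 4 * (κ * R) = R * (4 * κ) := by ring
      _ ≤ R * (cmin * Real.exp (-(2 * c₀))) := mul_le_mul_of_nonneg_left hκ hR
      _ = R * cmin * Real.exp (-(2 * c₀)) := by ring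
      _ ≤ _ := mul_le_mul hbal (exp_le_prod_foreignHubs hL hc₀ hc₀L H4 i) (Real.exp_pos _).le
          (Nat.cast_nonneg _)

lemma condProb_le_card_class (hA0 : ∀ i j, 0 ≤ A i j) (hA1 : ∀ i j, A i j ≤ 1)
    (H2 : ScaledEntries smin smax d s A) (hd : 0 < d) (hR : 0 ≤ R)
    (hη : 4 * (cmax * (smax * d)) ≤ η) {i : Fin (L + 1)} {j : Fin n}
    (hbal : labelCount ζ i ≤ R * cmax) (hij : ¬ IsHubOf i j) :
    condProb A ζ {g | η * R ≤
      ((Finset.univ.filter fun t => ζ t = i ∧ g t j = true).card : ℝ)} ≤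
      Real.exp (-(η / 2 * R)) := by
  classical
  -- The mean is at most `η * R / 4`, which leaves the exponent `-η * R + η * R / 2`.
  have h := condProb_le_card_le (ζ := ζ) hA0 hA1 (fun i' => i' = i) {j} true
    (a := η * R) (M := R * cmax * (smax * d)) ?_
  · refine (condProb_mono hA0 hA1 ?_).trans (h.trans (Real.exp_le_exp.2 (by nlinarith)))
    intro g hg _
    rw [Set.mem_ofPred_eq] at hg ⊢
    convert hg using 4
    simp
  · have hsum : ∑ t, (if ζ t = i then ∏ j' ∈ {j}, bern (A (ζ t) j') true else 0) =
        labelCount ζ i * A i j := by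
      rw [← Finset.sum_filter, labelCount, ← nsmul_eq_mul, ← Finset.sum_const]
      refine Finset.sum_congr rfl fun t ht => ?_
      rw [(Finset.mem_filter.1 ht).2]
      simp [bern]
    rw [hsum]
    have hA : A i j ≤ smax * d := by
      rw [(H2 i j hij).1]
      exact mul_le_mul_of_nonneg_right (H2 i j hij).2.2 hd.le
    exact mul_le_mul hbal hA (hA0 i j) ((Nat.cast_nonneg _).trans hbal)

/-- The foreign hub `h` costs a factor `c₀ / L`, and `j` a further `smax * d`, except in groups
formed by `j` itself, of which there are at most `R * cmax`. The mean is thus at most `R * (c₀ *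
(smax * d) + c₀ / L * cmax)`, a small multiple of `R`. -/
lemma condProb_le_card_foreign (hA0 : ∀ i j, 0 ≤ A i j) (hA1 : ∀ i j, A i j ≤ 1)
    (hL : 0 < L) (hc₀ : 0 < c₀) (hsd : 0 ≤ smax * d) (H2 : ScaledEntries smin smax d s A)
    (hd : 0 < d) (H4 : RareHubs c₀ A) (hR : 0 ≤ R) (hRT : R * L = T)
    (hη : 4 * (c₀ * (smax * d) + c₀ / L * cmax) ≤ η)
    (hbal : ∀ i, labelCount ζ i ≤ R * cmax) {i : Fin (L + 1)} {h j : Fin n}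
    (hih : IsHubOf i h) (hjh : j ≠ h) :
    condProb A ζ {g | η * R ≤
      ((Finset.univ.filter fun t => ζ t ≠ i ∧ g t h = true ∧ g t j = true).card : ℝ)} ≤
      Real.exp (-(η / 2 * R)) := by
  classical
  have hL' : (0 : ℝ) < L := by exact_mod_cast hL
  have hb := condProb_le_card_le (ζ := ζ) hA0 hA1 (fun i' => i' ≠ i) {h, j} true
    (a := η * R) (M := c₀ / L * (T * (smax * d) + R * cmax)) ?_
  · refine (condProb_mono hA0 hA1 ?_).trans (hb.trans (Real.exp_le_exp.2 ?_))
    · intro g hg _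
      rw [Set.mem_ofPred_eq] at hg ⊢
      convert hg using 4
      simp
    · have : c₀ / L * (T * (smax * d) + R * cmax) =
          R * (c₀ * (smax * d) + c₀ / L * cmax) := by
        rw [← hRT]; field_simp
      rw [this]
      nlinarith
  · have hhub : ((Finset.univ.filter fun t => IsHubOf (ζ t) j).card : ℝ) ≤ R * cmax := by
      by_cases hex : ∃ i', IsHubOf (L := L) i' j
      · obtain ⟨i', hi'⟩ := hex
        refine le_trans ?_ (hbal i')
        rw [labelCount]
        exact_mod_cast Finset.card_le_card
          (Finset.monotone_filter_right (p := fun t => IsHubOf (ζ t) j) _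
            fun t _ ht => Fin.ext (Eq.trans ht hi'.symm))
      · have : (Finset.univ.filter fun t => IsHubOf (ζ t) j) = ∅ :=
          Finset.filter_eq_empty_iff.2 fun t _ ht => hex ⟨_, ht⟩
        rw [this, Finset.card_empty, Nat.cast_zero]
        exact (Nat.cast_nonneg _).trans (hbal 0)
    calc _ ≤ ∑ t, c₀ / L * (smax * d + if IsHubOf (ζ t) j then 1 else 0) := by
          refine Finset.sum_le_sum fun t _ => ?_
          have hq : 0 ≤ smax * d + if IsHubOf (ζ t) j then (1 : ℝ) else 0 := by
            split_ifs <;> linarith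
          split_ifs with ht hj hj
          · rw [Finset.prod_pair hjh.symm]
            have h1 : A (ζ t) h ≤ c₀ / L := by
              refine H4 _ _ ?_ fun hh => ht (Fin.ext (Eq.trans hh hih.symm))
              have := i.isLt
              unfold IsHubOf at hih
              unfold IsFollower
              omega
            simp only [bern, if_true]
            exact mul_le_mul h1 (by linarith [hA1 (ζ t) j]) (hA0 _ _) (by positivity)
          · rw [Finset.prod_pair hjh.symm]
            have h1 : A (ζ t) h ≤ c₀ / L := by
              refine H4 _ _ ?_ fun hh => ht (Fin.ext (Eq.trans hh hih.symm))
              have := i.isLt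
              unfold IsHubOf at hih
              unfold IsFollower
              omega
            have h2 : A (ζ t) j ≤ smax * d := by
              rw [(H2 _ j hj).1]
              exact mul_le_mul_of_nonneg_right (H2 _ j hj).2.2 hd.le
            simp only [bern, if_true]
            exact mul_le_mul h1 (by linarith) (hA0 _ _) (by positivity)
          · positivity
          · positivity
      _ = c₀ / L * (T * (smax * d) +
            ((Finset.univ.filter fun t => IsHubOf (ζ t) j).card : ℝ)) := by
          rw [← Finset.mul_sum, Finset.sum_add_distrib, Finset.card_filter]
          simp
      _ ≤ _ := by gcongr

/-- A bound, given balanced labels, on the probability that some entry is badly estimated. -/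
lemma condProb_le_maxError_le (hL : 0 < L) (hLn : L < n) (hA0 : ∀ i j, 0 ≤ A i j)
    (hA1 : ∀ i j, A i j ≤ 1) (hub : ∀ i j, IsHubOf i j → A i j = 1) (hsmin : 0 < smin)
    (hs : 0 < smax) (hd : 0 < d) (hτ : 0 < τ) (hv : 0 < v) (H2 : ScaledEntries smin smax d s A)
    (H3 : SeparatedHubs v τ s) (hc₀ : 0 < c₀) (H4 : RareHubs c₀ A) (hR : 0 < R) (hRT : R * L = T)
    (hbal : ∀ i, R * cmin ≤ labelCount ζ i ∧ labelCount ζ i ≤ R * cmax)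
    (hκ0 : 0 < κ) (hκ : 4 * κ ≤ cmin * Real.exp (-(2 * c₀))) (hη : 0 < η) (hηκ : 2 * η ≤ κ)
    (hηε : 4 * η ≤ ε * κ) (hθ0 : 0 < θ) (hθ1 : θ ≤ 1) (hθ : θ * cmax ≤ κ) (hβκ : β ≤ κ)
    (hβη : β ≤ η / 2) (hc₀L : 2 * c₀ ≤ L) (hd1 : smax * d < 1) (hdε : smax * d < ε)
    (hM3 : 4 * (cmax * (smax * d)) ≤ η) (hM4 : 4 * (c₀ * (smax * d) + c₀ / L * cmax) ≤ η)
    (hmain : T * Real.log (L + 1) + 2 * n * (L + 1) * Real.log (T + 1) + T * (L * Real.log 2) -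
      v * n / L * (η * R) * (θ * τ ^ 2 * d / (8 * smax)) / 2 ≤ -T)
    {zhat : (Fin T → Fin n → Bool) → Fin T → Fin (L + 1)} (hzhat : ∀ g, IsMPLE g (zhat g)) :
    condProb A ζ {g | ε ≤ maxError A g (zhat g)} ≤
      3 * (n : ℝ) ^ 3 * Real.exp (-(β * R)) + Real.exp (-T) := by
  classical
  have hsd : 0 ≤ smax * d := by positivity
  have hb0 : 0 ≤ Real.exp (-(β * R)) := (Real.exp_pos _).le
  have hAle : ∀ i j, ¬ IsHubOf i j → A i j ≤ smax * d := fun i j hij => by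
    rw [(H2 i j hij).1]
    exact mul_le_mul_of_nonneg_right (H2 i j hij).2.2 hd.le
  have hfol : ∀ (i : Fin (L + 1)) (j : Fin n), L ≤ (j : ℕ) → ¬ IsHubOf i j := fun i j hj h => by
    have := i.isLt
    unfold IsHubOf at h
    omega
  have hpos : ∀ i (j : Fin n), L ≤ (j : ℕ) → 0 < A i j := fun i j hj => by
    rw [(H2 i j (hfol i j hj)).1]
    exact mul_pos (hsmin.trans_le (H2 i j (hfol i j hj)).2.1) hd
  set S2 : Fin (L + 1) → Set (Fin T → Fin n → Bool) := fun i =>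
    {g | ((Finset.univ.filter fun t =>
      ζ t = i ∧ ∀ j ∈ foreignHubs n i, g t j = false).card : ℝ) ≤ κ * R} with hS2
  set S3 : Fin (L + 1) × Fin n → Set (Fin T → Fin n → Bool) := fun p => {g | ¬ IsHubOf p.1 p.2 ∧
    η * R ≤ ((Finset.univ.filter fun t => ζ t = p.1 ∧ g t p.2 = true).card : ℝ)} with hS3
  set S4 : Fin (L + 1) × Fin n × Fin n → Set (Fin T → Fin n → Bool) := fun p =>
    {g | (IsHubOf p.1 p.2.1 ∧ p.2.2 ≠ p.2.1) ∧ η * R ≤ ((Finset.univ.filter fun t =>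
      ζ t ≠ p.1 ∧ g t p.2.1 = true ∧ g t p.2.2 = true).card : ℝ)} with hS4
  set Z : Set (Fin T → Fin (L + 1)) :=
    {z | κ * R ≤ ((Finset.univ.filter fun t => ζ t = 0 ∧ z t = 0).card : ℝ) ∧
      η * R ≤ ((Finset.univ.filter fun t => ζ t ≠ 0 ∧ z t = 0).card : ℝ)} with hZ
  set S5 : Set (Fin T → Fin n → Bool) :=
    {g | ∃ z ∈ Z, profileLogLik g ζ ≤ profileLogLik g z} with hS5
  have hsub : condProb A ζ {g | ε ≤ maxError A g (zhat g)} ≤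
      condProb A ζ ((((⋃ i, S2 i) ∪ ⋃ p, S3 p) ∪ ⋃ p, S4 p) ∪ S5) := by
    -- Outside the four bad events `maxError_lt` applies; the nonzero weight `hw` supplies
    -- feasibility of `ζ`.
    refine condProb_mono hA0 hA1 fun g hg hw => ?_
    by_contra hbad
    simp only [Set.mem_union, Set.mem_iUnion, not_or, not_exists, hS2, hS3, hS4, hS5, hZ,
      Set.mem_ofPred_eq, not_le, not_and] at hbad
    obtain ⟨⟨⟨h2, h3⟩, h4⟩, h5⟩ := hbad
    refine (maxError_lt hLn hA0 hub (feasible_of_condWeight_ne_zero hub hw) (hzhat g)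
      (m := κ * R) (η := η * R) (mul_pos hη hR) (by nlinarith) (by nlinarith)
      (fun i j hij => (hAle i j hij).trans_lt hdε) h2 (fun i j hij => h3 (i, j) hij)
      (fun i h j hih hjh => h4 (i, h, j) ⟨hih, hjh⟩) fun hm he => ?_).not_ge hg
    exact h5 _ ⟨hm, he⟩
  have h2 : condProb A ζ (⋃ i, S2 i) ≤ (n : ℝ) ^ 3 * Real.exp (-(β * R)) := by
    refine (condProb_iUnion_le hA0 hA1 S2 (b := Real.exp (-(β * R))) fun i => ?_).trans ?_
    · refine (condProb_card_foreignHubs_le hA0 hA1 hL hc₀ hc₀L H4 hR.le hκ0.le hκ i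
        (hbal i).1).trans (Real.exp_le_exp.2 ?_)
      nlinarith
    · refine mul_le_mul_of_nonneg_right ?_ hb0
      rw [Fintype.card_fin]
      exact_mod_cast (show L + 1 ≤ n from hLn).trans (Nat.le_self_pow three_ne_zero n)
  have h3 : condProb A ζ (⋃ p, S3 p) ≤ (n : ℝ) ^ 3 * Real.exp (-(β * R)) := by
    refine (condProb_iUnion_le hA0 hA1 S3 (b := Real.exp (-(β * R))) fun p => ?_).trans ?_
    · by_cases hp : IsHubOf p.1 p.2
      · simpa [condProb, hS3, hp] using hb0
      · refine (condProb_mono hA0 hA1 fun g hg _ => hg.2).trans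
          ((condProb_le_card_class hA0 hA1 H2 hd hR.le hM3 (hbal p.1).2 hp).trans
            (Real.exp_le_exp.2 ?_))
        nlinarith
    · refine mul_le_mul_of_nonneg_right ?_ hb0
      rw [Fintype.card_prod, Fintype.card_fin, Fintype.card_fin]
      have : (L + 1) * n ≤ n ^ 3 := calc
        (L + 1) * n ≤ n * n := Nat.mul_le_mul_right n hLn
        _ = n ^ 2 := (sq n).symm
        _ ≤ n ^ 3 := Nat.pow_le_pow_right (by omega) (by norm_num)
      exact_mod_cast this
  have h4 : condProb A ζ (⋃ p, S4 p) ≤ (n : ℝ) ^ 3 * Real.exp (-(β * R)) := by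
    refine (condProb_iUnion_le hA0 hA1 S4 (b := Real.exp (-(β * R))) fun p => ?_).trans ?_
    · by_cases hp : IsHubOf p.1 p.2.1 ∧ p.2.2 ≠ p.2.1
      · refine (condProb_mono hA0 hA1 fun g hg _ => hg.2).trans
          ((condProb_le_card_foreign hA0 hA1 hL hc₀ hsd H2 hd H4 hR.le hRT hM4
            (fun i => (hbal i).2) hp.1 hp.2).trans (Real.exp_le_exp.2 ?_))
        nlinarith
      · have : S4 p = ∅ := Set.eq_empty_of_forall_notMem fun g hg => hp hg.1
        rw [this]
        simpa [condProb] using hb0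
    · refine mul_le_mul_of_nonneg_right ?_ hb0
      rw [Fintype.card_prod, Fintype.card_prod, Fintype.card_fin, Fintype.card_fin]
      have : (L + 1) * (n * n) ≤ n ^ 3 := calc
        (L + 1) * (n * n) ≤ n * (n * n) := Nat.mul_le_mul_right _ hLn
        _ = n ^ 3 := by ring
      exact_mod_cast this
  have h5 : condProb A ζ S5 ≤ Real.exp (-T) := by
    refine (condProb_exists_profileLogLik_le hA0 hA1 hpos
      (fun i j hj => (hAle i j (hfol i j hj)).trans_lt hd1) Z
      (H := v * n / L * (η * R) * (θ * τ ^ 2 * d / (8 * smax))) ?_).trans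
      (Real.exp_le_exp.2 hmain)
    intro z hz B _
    refine le_trans ?_ (le_sum_sq_sqrt_sub_sqrt hA0 hs hd hτ H2 H3 hθ0 hθ1
      (fun i => (hbal i).2) ?_ B)
    · have := hz.2
      gcongr
    -- Here `C = R * cmax`, and `θ * cmax ≤ κ` is what the choice of `θ` ensures.
    · refine le_trans ?_ hz.1
      nlinarith
  have hu1 := condProb_union_le (ζ := ζ) hA0 hA1 (((⋃ i, S2 i) ∪ ⋃ p, S3 p) ∪ ⋃ p, S4 p) S5
  have hu2 := condProb_union_le (ζ := ζ) hA0 hA1 ((⋃ i, S2 i) ∪ ⋃ p, S3 p) (⋃ p, S4 p)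
  have hu3 := condProb_union_le (ζ := ζ) hA0 hA1 (⋃ i, S2 i) (⋃ p, S3 p)
  linarith

end FiniteSample

/-! ### Rates and passage to the limit -/

/-- Under the rate conditions the separation dominates the complexity of the label assignments. -/
lemma log_complexity_le {L n T d v Γ : ℝ} (hL : 1 ≤ L) (hΓ : 16 ≤ Γ * L) (hT : 2 ≤ T) (hn : 0 ≤ n)
    (h8 : L ^ 8 ≤ d * n * v) (h5 : L ^ 5 * Real.log T ≤ d * T * v) :
    T * Real.log (L + 1) + 2 * n * (L + 1) * Real.log (T + 1) + T * (L * Real.log 2) -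
      Γ * (v * n * d * T / L ^ 2) ≤ -T := by
  have hL0 : 0 < L := by linarith
  have hΓ0 : 0 < Γ := by
    by_contra! h
    nlinarith
  have hlogL : Real.log (L + 1) ≤ L := by
    have := Real.log_le_sub_one_of_pos (show 0 < L + 1 by linarith)
    linarith
  have hlog2 : Real.log 2 ≤ 1 := by linarith [Real.log_two_lt_d9]
  have hlT0 : 0 ≤ Real.log T := Real.log_nonneg (by linarith)
  have hlogT : Real.log (T + 1) ≤ 2 * Real.log T := by
    have : 2 * Real.log T = Real.log (T ^ 2) := by rw [Real.log_pow]; norm_num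
    rw [this]
    exact Real.log_le_log (by linarith) (by nlinarith)
  have e1 : T * Real.log (L + 1) ≤ T * L := mul_le_mul_of_nonneg_left hlogL (by linarith)
  have e2 : T * (L * Real.log 2) ≤ T * L := mul_le_mul_of_nonneg_left (by nlinarith) (by linarith)
  have e3 : T ≤ T * L := by nlinarith
  have e4 : 2 * n * (L + 1) * Real.log (T + 1) ≤ 2 * n * (2 * L) * (2 * Real.log T) := by
    have hp : 0 ≤ Real.log (T + 1) := Real.log_nonneg (by linarith)
    gcongr
    linarith
  have hL4 : L ≤ L ^ 5 := le_self_pow₀ hL (by norm_num)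
  have hL2 : L ≤ L ^ 2 := le_self_pow₀ hL (by norm_num)
  have e5 : 16 * L ^ 3 ≤ Γ * (v * n * d) := by
    calc 16 * L ^ 3 ≤ Γ * L ^ 5 * L ^ 3 := by
          have : 16 ≤ Γ * L ^ 5 := hΓ.trans (mul_le_mul_of_nonneg_left hL4 hΓ0.le)
          gcongr
      _ = Γ * L ^ 8 := by ring
      _ ≤ Γ * (d * n * v) := mul_le_mul_of_nonneg_left h8 hΓ0.le
      _ = _ := by ring
  have e6 : 16 * L ^ 3 * Real.log T ≤ Γ * (v * d * T) := by
    calc 16 * L ^ 3 * Real.log T ≤ Γ * L ^ 2 * L ^ 3 * Real.log T := by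
          have : 16 ≤ Γ * L ^ 2 := hΓ.trans (mul_le_mul_of_nonneg_left hL2 hΓ0.le)
          gcongr
      _ = Γ * (L ^ 5 * Real.log T) := by ring
      _ ≤ Γ * (d * T * v) := mul_le_mul_of_nonneg_left h5 hΓ0.le
      _ = _ := by ring
  have e7 : 16 * L * T ≤ Γ * (v * n * d * T / L ^ 2) := by
    rw [← mul_div_assoc, le_div_iff₀ (by positivity)]
    nlinarith
  have e8 : 16 * L * n * Real.log T ≤ Γ * (v * n * d * T / L ^ 2) := by
    rw [← mul_div_assoc, le_div_iff₀ (by positivity)]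
    nlinarith
  -- The complexity terms together with `T` are at most `3 * L * T + 8 * L * n * log T`, and the
  -- average of `e7` and `e8` gives `8 * L * T + 8 * L * n * log T`.
  nlinarith

lemma real_le_maxError_le {Ω : Type*} [MeasurableSpace Ω] {P : Measure Ω} [IsProbabilityMeasure P]
    {L n T : ℕ} {ρ : Fin (L + 1) → ℝ} {A : Fin (L + 1) → Fin n → ℝ}
    {z : Ω → Fin T → Fin (L + 1)} {G : Ω → Fin T → Fin n → Bool} (hρA : IsParam ρ A)
    (h : IsHubSample P ρ A z G) {cmin cmax ε b : ℝ} (hb : 0 ≤ b)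
    {zhat : (Fin T → Fin n → Bool) → Fin T → Fin (L + 1)}
    (hcond : ∀ ζ, BalancedLabels cmin cmax ζ →
      condProb A ζ {g | ε ≤ maxError A g (zhat g)} ≤ b) :
    P.real {ω | ε ≤ maxError A (G ω) (zhat (G ω))} ≤
      (1 - P.real {ω | BalancedLabels cmin cmax (z ω)}) + b := by
  have hmeas : MeasurableSet {ω | BalancedLabels cmin cmax (z ω)} :=
    h.measurable_label (Set.toFinite {ζ | BalancedLabels cmin cmax ζ}).measurableSet
  have h1 := h.real_le_of_condProb_le hρA {ζ | BalancedLabels cmin cmax ζ}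
    {g | ε ≤ maxError A g (zhat g)} hb hcond
  rw [← probReal_compl_eq_one_sub hmeas]
  refine le_trans (measureReal_mono (s₂ := {ω | BalancedLabels cmin cmax (z ω)}ᶜ ∪
    {ω | z ω ∈ {ζ | BalancedLabels cmin cmax ζ} ∧ G ω ∈ {g | ε ≤ maxError A g (zhat g)}})
    (fun ω hω => ?_) (measure_ne_top _ _)) ((measureReal_union_le _ _).trans (by gcongr))
  by_cases hB : BalancedLabels cmin cmax (z ω)
  · exact Or.inr ⟨hB, hω⟩
  · exact Or.inl hB

end HubNull

theorem theorem6
    -- sizes of the hub set, of the node set and of the sample, along a sequence of models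
    (nL n T : ℕ → ℕ) (hnLn : ∀ k, nL k < n k)
    (hnL : Tendsto nL atTop atTop) (hn : Tendsto n atTop atTop) (hT : Tendsto T atTop atTop)
    -- the models and their samples
    (ρ : ∀ k, Fin (nL k + 1) → ℝ) (A : ∀ k, Fin (nL k + 1) → Fin (n k) → ℝ)
    (hparam : ∀ k, HubNull.IsParam (ρ k) (A k))
    (Ω : ℕ → Type*) [∀ k, MeasurableSpace (Ω k)] (P : ∀ k, Measure (Ω k))
    [∀ k, IsProbabilityMeasure (P k)]
    (zstar : ∀ k, Ω k → Fin (T k) → Fin (nL k + 1))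
    (G : ∀ k, Ω k → Fin (T k) → Fin (n k) → Bool)
    (hsample : ∀ k, HubNull.IsHubSample (P k) (ρ k) (A k) (zstar k) (G k))
    -- balanced labels, with probability tending to one
    (cmin cmax : ℝ) (hcmin : 0 < cmin)
    (H1 : Tendsto (fun k => (P k).real {ω | HubNull.BalancedLabels cmin cmax (zstar k ω)})
      atTop (𝓝 1))
    -- scaling of the entries
    (smin smax : ℝ) (hsmin : 0 < smin)
    (d : ℕ → ℝ) (hdpos : ∀ k, 0 < d k) (hd : Tendsto d atTop (𝓝 0))
    (s : ∀ k, Fin (nL k + 1) → Fin (n k) → ℝ)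
    (H2 : ∀ k, HubNull.ScaledEntries smin smax (d k) (s k) (A k))
    -- separation of the hubs
    (v : ℕ → ℝ) (hvpos : ∀ k, 0 < v k) (τ₀ : ℝ) (hτ₀ : 0 < τ₀)
    (H3 : ∀ k, HubNull.SeparatedHubs (v k) τ₀ (s k))
    -- hub set members are rare in groups that they do not form
    (c₀ : ℝ) (hc₀ : 0 < c₀) (H4 : ∀ k, HubNull.RareHubs c₀ (A k))
    -- rates
    (hr1 : Tendsto (fun k => (nL k : ℝ) * Real.log (n k) / (T k : ℝ)) atTop (𝓝 0))
    (hr2 : Tendsto (fun k => (nL k : ℝ) ^ 5 * Real.log (T k) / (d k * (T k : ℝ) * v k))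
      atTop (𝓝 0))
    (hr3 : Tendsto (fun k => Real.log (d k) ^ 2 * (nL k : ℝ) ^ 8 * Real.log (nL k) /
      (d k * (n k : ℝ) * v k ^ 2)) atTop (𝓝 0))
    (hr4 : Tendsto (fun k => Real.log (T k) ^ 2 * (nL k : ℝ) ^ 8 * Real.log (nL k) /
      (d k * (n k : ℝ) * v k ^ 2)) atTop (𝓝 0))
    -- the estimated labels: any maximizer of the profile likelihood, as a function of the data
    (zhat : ∀ k, (Fin (T k) → Fin (n k) → Bool) → Fin (T k) → Fin (nL k + 1))
    (hzhat : ∀ k g, HubNull.IsMPLE g (zhat k g)) :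
    ∀ ε : ℝ, 0 < ε →
      Tendsto (fun k => (P k).real
        {ω | ε ≤ HubNull.maxError (A k) (G k ω) (zhat k (G k ω))}) atTop (𝓝 0) := by
  intro ε hε
  have hLr : Tendsto (fun k => (nL k : ℝ)) atTop atTop := tendsto_natCast_atTop_atTop.comp hnL
  have hnr : Tendsto (fun k => (n k : ℝ)) atTop atTop := tendsto_natCast_atTop_atTop.comp hn
  have hTr : Tendsto (fun k => (T k : ℝ)) atTop atTop := tendsto_natCast_atTop_atTop.comp hT
  have hs : 0 < smax := by
    have := (H2 0 0 ⟨0, by have := hnLn 0; omega⟩ (by simp [HubNull.IsHubOf])).2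
    linarith
  -- A nonpositive `cmax` would eventually leave no balanced labels, against `H1`.
  rcases le_or_gt cmax 0 with hcmax | hcmax
  · exfalso
    have h1 := (hLr.eventually_ge_atTop 1).and ((hTr.eventually_ge_atTop 1).and
      (H1.eventually (lt_mem_nhds one_pos)))
    obtain ⟨k, hL, hT1, hk⟩ := h1.exists
    have : {ω | HubNull.BalancedLabels cmin cmax (zstar k ω)} = ∅ := by
      refine Set.eq_empty_of_forall_notMem fun ω hω => ?_
      have h2 := hω 0
      have h3 : 0 < (T k : ℝ) * cmin / nL k := by positivity
      have h4 : (T k : ℝ) * cmax / nL k ≤ 0 :=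
        div_nonpos_of_nonpos_of_nonneg (mul_nonpos_of_nonneg_of_nonpos (by positivity) hcmax)
          (by positivity)
      linarith
    rw [this] at hk
    simp at hk
  -- In units of `R`, `κ` is the guaranteed size of the part of a class free of foreign hubs and `η`
  -- the tolerated number of errors. `θ` compares `κ` with the largest class, `β` is a common
  -- exponent for the tails, and `Γ` gathers the constants of half the Hellinger distance.
  set κ := cmin * Real.exp (-(2 * c₀)) / 4 with hκ
  have hκ0 : 0 < κ := by positivity
  set η := min (κ / 2) (ε * κ / 4) with hη
  have hη0 : 0 < η := lt_min (by positivity) (by positivity)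
  have hη1 : η ≤ κ / 2 := min_le_left _ _
  have hη2 : η ≤ ε * κ / 4 := min_le_right _ _
  set θ := min 1 (κ / cmax) with hθ
  have hθ0 : 0 < θ := lt_min one_pos (by positivity)
  have hθ1 : θ * cmax ≤ κ := (le_div_iff₀ hcmax).1 (min_le_right _ _)
  set β := min κ (η / 2) with hβ
  have hβ0 : 0 < β := lt_min hκ0 (by positivity)
  set Γ := η * θ * τ₀ ^ 2 / (16 * smax) with hΓ
  have hΓ0 : 0 < Γ := by positivity
  have hsd : Tendsto (fun k => smax * d k) atTop (𝓝 0) := by simpa using hd.const_mul smax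
  have hM3 : Tendsto (fun k => 4 * (cmax * (smax * d k))) atTop (𝓝 0) := by
    simpa using (hsd.const_mul cmax).const_mul 4
  have hM4 : Tendsto (fun k => 4 * (c₀ * (smax * d k) + c₀ / nL k * cmax)) atTop (𝓝 0) := by
    simpa using ((hsd.const_mul c₀).add ((hLr.const_div_atTop c₀).mul_const cmax)).const_mul 4
  have hlogd : Tendsto (fun k => Real.log (d k)) atTop atBot :=
    Real.tendsto_log_nhdsGT_zero.comp
      (tendsto_nhdsWithin_iff.2 ⟨hd, Eventually.of_forall hdpos⟩)
  have hlogL : Tendsto (fun k => Real.log (nL k)) atTop atTop := Real.tendsto_log_atTop.comp hLr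
  have hbound : ∀ᶠ k in atTop, (P k).real
      {ω | ε ≤ HubNull.maxError (A k) (G k ω) (zhat k (G k ω))} ≤
        (1 - (P k).real {ω | HubNull.BalancedLabels cmin cmax (zstar k ω)}) +
          (3 * (n k : ℝ)⁻¹ + Real.exp (-(T k : ℝ))) := by
    filter_upwards [hLr.eventually_ge_atTop 1, hLr.eventually_ge_atTop (16 / Γ),
      hLr.eventually_ge_atTop (2 * c₀), hTr.eventually_ge_atTop 2,
      hsd.eventually (gt_mem_nhds one_pos), hsd.eventually (gt_mem_nhds hε),
      hM3.eventually (gt_mem_nhds hη0), hM4.eventually (gt_mem_nhds hη0),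
      hlogd.eventually_le_atBot (-1), hlogL.eventually_ge_atTop 1,
      hr1.eventually (gt_mem_nhds (show 0 < β / 4 by positivity)),
      hr2.eventually (gt_mem_nhds one_pos), hr3.eventually (gt_mem_nhds one_pos)]
      with k hL1 hLΓ hLc hT2 hd1 hdε hM3k hM4k hld hlL hr1k hr2k hr3k
    have hL0 : 0 < nL k := by
      have : (0 : ℝ) < nL k := by linarith
      exact_mod_cast this
    have hn0 : 0 < n k := hL0.trans (hnLn k)
    have hn0' : (0 : ℝ) < n k := by exact_mod_cast hn0
    have hL0' : (0 : ℝ) < nL k := by exact_mod_cast hL0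
    have hT0' : (0 : ℝ) < T k := by linarith
    have hdk := hdpos k
    have hvk := hvpos k
    have hp := hparam k
    have hv1 : v k ≤ 1 := (H3 k).le_one hτ₀ hL0 hn0
    -- Eventually `log d ≤ -1` and `log L ≥ 1`, so both logarithmic factors can be dropped; `v ≤ 1`
    -- turns `v ^ 2` into `v`.
    have h8 : (nL k : ℝ) ^ 8 ≤ d k * n k * v k := by
      rw [div_lt_one (by positivity)] at hr3k
      have e1 : (1 : ℝ) ≤ Real.log (d k) ^ 2 := by nlinarith
      calc (nL k : ℝ) ^ 8 ≤ Real.log (d k) ^ 2 * (nL k : ℝ) ^ 8 * Real.log (nL k) := by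
            have h1 : (nL k : ℝ) ^ 8 ≤ Real.log (d k) ^ 2 * (nL k : ℝ) ^ 8 :=
              le_mul_of_one_le_left (by positivity) e1
            exact h1.trans (le_mul_of_one_le_right (by positivity) hlL)
        _ ≤ d k * n k * v k ^ 2 := hr3k.le
        _ ≤ d k * n k * v k := by
            refine mul_le_mul_of_nonneg_left ?_ (by positivity)
            nlinarith
    have h5 : (nL k : ℝ) ^ 5 * Real.log (T k) ≤ d k * T k * v k := by
      rw [div_lt_one (by positivity)] at hr2k
      exact hr2k.le
    have hmain := HubNull.log_complexity_le hL1 ((div_le_iff₀' hΓ0).1 hLΓ) hT2 hn0'.le h8 h5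
    set R := (T k : ℝ) / nL k with hR
    have hR0 : 0 < R := by positivity
    -- Four powers of `n`: three for the union bounds and one for decay.
    have hlog : 4 * Real.log (n k) ≤ β * R := by
      rw [div_lt_iff₀ hT0'] at hr1k
      rw [hR, ← mul_div_assoc, le_div_iff₀ hL0']
      linarith
    have hexp : (n k : ℝ) ^ 3 * Real.exp (-(β * R)) ≤ (n k : ℝ)⁻¹ := by
      have : Real.exp (-(β * R)) ≤ ((n k : ℝ) ^ 4)⁻¹ := by
        rw [← Real.exp_log (show 0 < ((n k : ℝ) ^ 4)⁻¹ by positivity), Real.exp_le_exp,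
          Real.log_inv, Real.log_pow]
        push_cast
        linarith
      calc _ ≤ (n k : ℝ) ^ 3 * ((n k : ℝ) ^ 4)⁻¹ := by gcongr
        _ = _ := by field_simp
    refine HubNull.real_le_maxError_le hp (hsample k) (by positivity) fun ζ hζ => ?_
    refine (HubNull.condProb_le_maxError_le (κ := κ) (η := η) (θ := θ) (β := β) (R := R)
      (cmin := cmin) (cmax := cmax) hL0 (hnLn k) hp.nonneg hp.le_one hp.hub hsmin hs hdk hτ₀ hvk
      (H2 k) (H3 k) hc₀ (H4 k) hR0 (by rw [hR]; field_simp) ?_ hκ0 (by rw [hκ]; linarith) hη0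
      (by linarith) (by linarith) hθ0 (min_le_left _ _) hθ1 (min_le_left _ _) (min_le_right _ _)
      hLc hd1 hdε hM3k.le hM4k.le ?_ (hzhat k)).trans (by linarith)
    · intro i
      have := hζ i
      rw [hR, div_mul_eq_mul_div, div_mul_eq_mul_div]
      exact this
    · convert hmain using 2
      rw [hR, hΓ]
      field_simp
      ring
  have hlim : Tendsto (fun k => (1 - (P k).real {ω | HubNull.BalancedLabels cmin cmax (zstar k ω)}) +
      (3 * (n k : ℝ)⁻¹ + Real.exp (-(T k : ℝ)))) atTop (𝓝 0) := by
    have h1 := (H1.const_sub 1).add (((tendsto_inv_atTop_zero.comp hnr).const_mul 3).add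
      (Real.tendsto_exp_neg_atTop_nhds_zero.comp hTr))
    simpa using h1
  exact tendsto_of_tendsto_of_tendsto_of_le_of_le' tendsto_const_nhds hlim
    (Eventually.of_forall fun k => measureReal_nonneg) hbound
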